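/- Let $n\ge 1$, $0<\alpha<2$, let $G\in C^1(\mathbb R)$ satisfy $G(0)=0$ and $G'(t)\ge c_0>0$ for all $t\in\mathbb R$, and put $$F_\alpha(u)(x)=C_{n,\alpha}\lim_{\varepsilon\to0^+}\int_{\mathbb R^n\setminus B_\varepsilon(x)}\frac{G(u(x)-u(z))}{|x-z|^{n+\alpha}}\,dz ,\qquad C_{n,\alpha}=\frac{\alpha\,2^{\alpha-1}\,\Gamma\!\left(\frac{n+\alpha}{2}\right)}{\pi^{n/2}\,\Gamma\!\left(1-\frac{\alpha}{2}\right)}$$ (so that $F_\alpha=(-\Delta)^{\alpha/2}$ when $G$ is the identity). Let $\mathbb R^n_+=\{x\in\mathbb R^n : x_n>0\}$ and let $L_\alpha$ be the set of $u\in L^1_{loc}(\mathbb R^n)$ with $\int_{\mathbb R^n}\frac{|u(x)|}{1+|x|^{n+\alpha}}\,dx<\infty$. Let $h:\mathbb R\to\mathbb R$, and let $u\in L_\alpha$ be a nonnegative function on $\mathbb R^n$ that is continuous on $\mathbb R^n$ and belongs to $C^{1,1}_{loc}(\mathbb R^n_+)$ (in particular, any nonnegative $u\in L_\alpha\cap C^{1,1}_{loc}(\mathbb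 R^n)$ is allowed). Suppose that $F_\alpha(u)(x)$ exists for every $x\in\mathbb R^n_+$ and $$F_\alpha(u)(x)=h(u(x))\quad\text{for } x\in\mathbb R^n_+,\qquad u(x)=0\quad\text{for } x\notin\mathbb R^n_+ .$$ Suppose further that $\lim_{|x|\to\infty}u(x)=0$, that $h$ is Lipschitz continuous on the range of $u$, and that $h(0)=0$. Then $u(x)=0$ for all $x\in\mathbb R^n$. -/

import Mathlib

open MeasureTheory Filter Topology

namespace HalfSpaceLiouville

/-- The normalizing constant `C_{n,α}` of the fractional Laplacian: with this constant the choice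
`G = id` in the operator below gives `(-Δ)^{α/2}` on `ℝⁿ`. It is positive for `0 < α < 2`. -/
noncomputable def normConst (n : ℕ) (α : ℝ) : ℝ :=
  α * (2 : ℝ) ^ (α - 1) * Real.Gamma (((n : ℝ) + α) / 2) /
    (Real.pi ^ ((n : ℝ) / 2) * Real.Gamma (1 - α / 2))

/-- The truncated integral `C_{n,α} ∫_{ℝⁿ ∖ B_ε(x)} G(u(x) - u(z)) / |x - z|^{n+α} dz`. -/
noncomputable def truncatedF {n : ℕ} (G : ℝ → ℝ) (α : ℝ) (u : EuclideanSpace ℝ (Fin n) → ℝ)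
    (x : EuclideanSpace ℝ (Fin n)) (ε : ℝ) : ℝ :=
  normConst n α *
    ∫ z in (Metric.ball x ε)ᶜ, G (u x - u z) / ‖x - z‖ ^ ((n : ℝ) + α)

/-- `F_α(u)(x)` exists and equals `y`: every truncated integral converges absolutely, and the
truncated integrals tend to `y` as `ε → 0⁺` (Cauchy principal value). -/
def HasFAlpha {n : ℕ} (G : ℝ → ℝ) (α : ℝ) (u : EuclideanSpace ℝ (Fin n) → ℝ)
    (x : EuclideanSpace ℝ (Fin n)) (y : ℝ) : Prop :=
  (∀ ε : ℝ, 0 < ε → IntegrableOn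
      (fun z => G (u x - u z) / ‖x - z‖ ^ ((n : ℝ) + α)) (Metric.ball x ε)ᶜ volume) ∧
    Tendsto (truncatedF G α u x) (𝓝[>] 0) (𝓝 y)

/-- `u ∈ L_α`: `u` is locally integrable on `ℝⁿ` and `∫ |u(x)| / (1 + |x|^{n+α}) dx < ∞`. -/
def MemLAlpha {n : ℕ} (α : ℝ) (u : EuclideanSpace ℝ (Fin n) → ℝ) : Prop :=
  LocallyIntegrable u volume ∧
    Integrable (fun x => |u x| / (1 + ‖x‖ ^ ((n : ℝ) + α))) volume

/-- `u ∈ C^{1,1}_loc(Ω)` for an open set `Ω`: `u` is differentiable in `Ω`, and its derivative is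
locally Lipschitz in `Ω`. -/
def IsC11LocOn {n : ℕ} (u : EuclideanSpace ℝ (Fin n) → ℝ)
    (Ω : Set (EuclideanSpace ℝ (Fin n))) : Prop :=
  DifferentiableOn ℝ u Ω ∧ LocallyLipschitzOn Ω (fderiv ℝ u)

/-- The open upper half space of `ℝ^{m+1}`: the last coordinate is positive. -/
def upperHalfSpace (m : ℕ) : Set (EuclideanSpace ℝ (Fin (m + 1))) :=
  {x | 0 < x (Fin.last m)}

end HalfSpaceLiouville

/-!
The proof is by moving planes along the inner normal `e`. Write `σ` for the reflection in
`⟪e, y⟫ = l`. If `u y ≤ u (σ y)` whenever `⟪e, y⟫ < l`, for every `l ≥ 0`, then letting `l → ∞` and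
using `u → 0` at infinity gives `u = 0`.

If the comparison fails for `l`, then `u (σ y) - u y` attains a negative minimum `-d` over
`⟪e, y⟫ < l`, at a point `x` of the half space. Subtracting the equations at `x` and `σ x` and
pairing each `y` with `σ y` bounds both

`c₀ ∫_{⟪e, y⟫ < l} (|x - y|^{-p} - |x - σ y|^{-p}) (u (σ y) - u y + d) dy`

and `2 c₀ d ∫_{⟪e, y⟫ < l} |x - σ y|^{-p} dy` by `h (u x) - h (u (σ x)) ≤ K d`. The second bound
keeps `x` at a distance at least `δ > 0` from the hyperplane. If the comparison holds for `l - η`,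
then `u (σ y) - u y + d` is at least `d - (u y - u (y - 2 η e))`, and the shift by `2 η e` can be
moved onto a Lipschitz cut-off; so the first bound fails for small `η`, uniformly in bounded `l`,
once the mass of `u` near `x` is at most `C d`.

That mass estimate has two parts. The mirror image of a ball where `u` vanishes carries mass at
most `C d`, again by the first bound. A weak Harnack inequality carries this over to the ball around
`x`: touch `u` from below by a paraboloid of height comparable to `d`, and use the equation at the
touching point. The singular integral of the linear part of the paraboloid, when it does not
converge absolutely, is bounded by scaling and rotation invariance, because it is bounded for one
slope: that of a paraboloid touching `u` from above.
-/

namespace HalfSpaceLiouville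

open Metric Module
open scoped RealInnerProductSpace

section Mirror

variable {E : Type*} [NormedAddCommGroup E] [InnerProductSpace ℝ E] {e : E} {l : ℝ}

/-- The reflection in the hyperplane `⟪e, y⟫ = l`, for a unit vector `e`. -/
noncomputable def mirror (e : E) (l : ℝ) : E ≃ᵢ E :=
  (Submodule.reflection (ℝ ∙ e)ᗮ).toIsometryEquiv.trans (IsometryEquiv.addRight ((2 * l) • e))

/-- The open half space `⟪e, y⟫ < l` bounded by the hyperplane of `mirror e l`. -/
def below (e : E) (l : ℝ) : Set E := {y | ⟪e, y⟫ < l}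

@[simp] lemma mem_below {y : E} : y ∈ below e l ↔ ⟪e, y⟫ < l := Iff.rfl

lemma isOpen_below : IsOpen (below e l) := isOpen_lt (by fun_prop) continuous_const

lemma inner_add_smul (he : ‖e‖ = 1) (x : E) (t : ℝ) : ⟪e, x + t • e⟫ = ⟪e, x⟫ + t := by
  rw [inner_add_right, inner_smul_right, real_inner_self_eq_norm_sq, he, one_pow, mul_one]

lemma inner_sub_smul (he : ‖e‖ = 1) (x : E) (t : ℝ) : ⟪e, x - t • e⟫ = ⟪e, x⟫ - t := by
  rw [sub_eq_add_neg, ← neg_smul, inner_add_smul he, sub_eq_add_neg]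

lemma mirror_apply (he : ‖e‖ = 1) (y : E) : mirror e l y = y + (2 * (l - ⟪e, y⟫)) • e := by
  have h : mirror e l y = Submodule.reflection (ℝ ∙ e)ᗮ y + (2 * l) • e := rfl
  rw [h, Submodule.reflection_orthogonal_apply, Submodule.reflection_singleton_apply, he]
  simp only [RCLike.ofReal_one, one_pow, div_one]
  module

lemma inner_mirror (he : ‖e‖ = 1) (y : E) : ⟪e, mirror e l y⟫ = 2 * l - ⟪e, y⟫ := by
  rw [mirror_apply he, inner_add_smul he]
  ring

lemma mirror_mirror (he : ‖e‖ = 1) (y : E) : mirror e l (mirror e l y) = y := by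
  rw [mirror_apply he (mirror e l y), inner_mirror he, mirror_apply he]
  module

lemma mirror_sub_smul (he : ‖e‖ = 1) (η : ℝ) (y : E) :
    mirror e l (y - (2 * η) • e) = mirror e (l + η) y := by
  rw [mirror_apply he, mirror_apply he, inner_sub_smul he]
  module

lemma norm_mirror_sub_mirror (x y : E) : ‖mirror e l x - mirror e l y‖ = ‖x - y‖ := by
  simp only [← dist_eq_norm, (mirror e l).dist_eq]

lemma norm_sub_mirror_sq (he : ‖e‖ = 1) (x y : E) :
    ‖x - mirror e l y‖ ^ 2 = ‖x - y‖ ^ 2 + 4 * (l - ⟪e, x⟫) * (l - ⟪e, y⟫) := by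
  rw [mirror_apply he, ← sub_sub, norm_sub_sq_real, inner_smul_right, inner_sub_left,
    real_inner_comm e x, real_inner_comm e y, norm_smul, he, Real.norm_eq_abs, mul_one, sq_abs]
  ring

lemma norm_sub_le_norm_sub_mirror (he : ‖e‖ = 1) {x y : E} (hx : ⟪e, x⟫ ≤ l) (hy : ⟪e, y⟫ ≤ l) :
    ‖x - y‖ ≤ ‖x - mirror e l y‖ := by
  refine le_of_sq_le_sq ?_ (norm_nonneg _)
  rw [norm_sub_mirror_sq he]
  nlinarith [mul_nonneg (sub_nonneg.2 hx) (sub_nonneg.2 hy)]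

lemma norm_sub_mirror_self (he : ‖e‖ = 1) {x : E} (hx : ⟪e, x⟫ ≤ l) :
    ‖x - mirror e l x‖ = 2 * (l - ⟪e, x⟫) := by
  rw [mirror_apply he, sub_add_cancel_left, norm_neg, norm_smul, he, mul_one,
    Real.norm_of_nonneg (by linarith)]

lemma abs_inner_sub_inner_le (he : ‖e‖ = 1) (x y : E) : |⟪e, x⟫ - ⟪e, y⟫| ≤ ‖x - y‖ := by
  rw [← inner_sub_right]
  simpa [he] using abs_real_inner_le_norm e (x - y)

lemma ball_subset_below (he : ‖e‖ = 1) {x : E} {r : ℝ} (hr : r ≤ l - ⟪e, x⟫) :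
    ball x r ⊆ below e l := fun y hy => by
  have := (le_abs_self _).trans (abs_inner_sub_inner_le he y x)
  rw [mem_ball_iff_norm] at hy
  rw [mem_below]
  linarith

lemma tendsto_mirror_cocompact [FiniteDimensional ℝ E] (he : ‖e‖ = 1) (x : E) :
    Tendsto (fun l => mirror e l x) atTop (cocompact E) := by
  rw [← Metric.cobounded_eq_cocompact, ← tendsto_norm_atTop_iff_cobounded]
  refine tendsto_atTop_mono (f := fun l : ℝ => 2 * l - ⟪e, x⟫) (fun l => ?_)
    (tendsto_atTop_add_const_right _ _ (tendsto_id.const_mul_atTop two_pos))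
  simpa [inner_mirror he, he] using real_inner_le_norm e (mirror e l x)

variable [MeasurableSpace E] [BorelSpace E]

lemma measurableSet_below : MeasurableSet (below e l) := isOpen_below.measurableSet

variable [FiniteDimensional ℝ E]

lemma measurableEmbedding_mirror : MeasurableEmbedding (mirror e l) :=
  (mirror e l).isometry.isClosedEmbedding.measurableEmbedding

lemma measurePreserving_mirror : MeasurePreserving (mirror e l) volume volume :=
  (measurePreserving_add_right volume ((2 * l) • e)).comp
    (Submodule.reflection (ℝ ∙ e)ᗮ).measurePreserving

lemma volume_inner_eq (he : e ≠ 0) (l : ℝ) : volume {y : E | ⟪e, y⟫ = l} = 0 := by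
  have hnull := Measure.addHaar_affineSubspace volume
    (AffineSubspace.mk' ((l / ‖e‖ ^ 2) • e) (ℝ ∙ e)ᗮ) fun htop => he <| by
      have : (l / ‖e‖ ^ 2) • e + e ∈ AffineSubspace.mk' ((l / ‖e‖ ^ 2) • e) (ℝ ∙ e)ᗮ :=
        htop ▸ AffineSubspace.mem_top ℝ E _
      simpa [AffineSubspace.mem_mk', Submodule.mem_orthogonal_singleton_iff_inner_right] using this
  convert hnull using 2
  ext y
  have : ‖e‖ ^ 2 ≠ 0 := by positivity
  simp [AffineSubspace.mem_mk', Submodule.mem_orthogonal_singleton_iff_inner_right,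
    inner_sub_right, inner_smul_right, this, sub_eq_zero]

lemma preimage_mirror_below_compl_ae_eq (he : ‖e‖ = 1) :
    mirror e l ⁻¹' (below e l)ᶜ =ᵐ[volume] below e l := by
  refine (ae_eq_set.2 ⟨measure_mono_null (fun y hy => ?_)
    (volume_inner_eq (norm_ne_zero_iff.1 (he ▸ one_ne_zero)) l),
    measure_mono_null (fun y hy => ?_) measure_empty⟩)
  all_goals
    simp only [Set.mem_sdiff, Set.mem_preimage, Set.mem_compl_iff, mem_below, inner_mirror he,
      not_lt, Set.mem_ofPred_eq] at hy ⊢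
    linarith [hy.1, hy.2]

lemma integrableOn_comp_mirror (he : ‖e‖ = 1) {g : E → ℝ} (hg : IntegrableOn g (below e l)ᶜ) :
    IntegrableOn (fun y => g (mirror e l y)) (below e l) :=
  ((measurePreserving_mirror.integrableOn_comp_preimage measurableEmbedding_mirror).2
    hg).congr_set_ae (preimage_mirror_below_compl_ae_eq he).symm

lemma setIntegral_below_compl (he : ‖e‖ = 1) (g : E → ℝ) :
    ∫ y in (below e l)ᶜ, g y = ∫ y in below e l, g (mirror e l y) := by
  rw [← measurePreserving_mirror.setIntegral_preimage_emb measurableEmbedding_mirror]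
  exact setIntegral_congr_set (preimage_mirror_below_compl_ae_eq he)

lemma setIntegral_compl_eq_add (he : ‖e‖ = 1) {g : E → ℝ} {B : Set E} (hBl : B ⊆ below e l)
    (hg : IntegrableOn g Bᶜ) :
    ∫ y in Bᶜ, g y = (∫ y in below e l \ B, g y) + ∫ y in below e l, g (mirror e l y) := by
  have hsplit : Bᶜ = (below e l \ B) ∪ (below e l)ᶜ := by
    ext y
    have := @hBl y
    simp only [Set.mem_compl_iff, Set.mem_union, Set.mem_sdiff]
    tauto
  rw [← setIntegral_below_compl he, hsplit,
    setIntegral_union (Set.disjoint_compl_right_iff_subset.2 Set.sdiff_subset)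
      measurableSet_below.compl (hg.mono_set fun y hy => hy.2)
      (hg.mono_set (Set.compl_subset_compl.2 hBl))]

end Mirror

lemma integrableOn_ball_of_continuous {X F : Type*} [MetricSpace X] [ProperSpace X]
    [MeasurableSpace X] [OpensMeasurableSpace X] {μ : Measure X} [IsFiniteMeasureOnCompacts μ]
    [NormedAddCommGroup F] {f : X → F} (hf : Continuous f) (x : X) (r : ℝ) :
    IntegrableOn f (ball x r) μ :=
  (hf.continuousOn.integrableOn_compact (isCompact_closedBall x r)).mono_set ball_subset_closedBall

section Kernel

variable {E : Type*} [NormedAddCommGroup E] [InnerProductSpace ℝ E] [FiniteDimensional ℝ E]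
  [MeasurableSpace E] [BorelSpace E] {p : ℝ}

lemma volume_real_ball (x : E) {r : ℝ} (hr : 0 < r) :
    volume.real (ball x r) = r ^ finrank ℝ E * volume.real (ball (0 : E) 1) := by
  simp [measureReal_def, Measure.addHaar_ball_of_pos volume x hr, ENNReal.toReal_ofReal, hr.le]

lemma volume_real_ball_pos (x : E) {r : ℝ} (hr : 0 < r) : 0 < volume.real (ball x r) :=
  ENNReal.toReal_pos (measure_ball_pos _ _ hr).ne' measure_ball_lt_top.ne

lemma integrableOn_norm_sub_rpow_compl_ball (hp : finrank ℝ E < p) (x : E) {r : ℝ} (hr : 0 < r) :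
    IntegrableOn (fun z => ‖x - z‖ ^ (-p)) (ball x r)ᶜ := by
  have : 0 < p := (Nat.cast_nonneg _).trans_lt hp
  have hdom := ((integrable_one_add_norm (μ := volume) hp).comp_sub_left x).const_mul
    ((1 / r + 1) ^ p)
  refine hdom.integrableOn.mono' (Measurable.aestronglyMeasurable (by fun_prop)) ?_
  refine (ae_restrict_mem measurableSet_ball.compl).mono fun z hz => ?_
  have hz : r ≤ ‖x - z‖ := by simpa [dist_eq_norm, norm_sub_rev] using hz
  have hpos : 0 < ‖x - z‖ := hr.trans_le hz
  have hle : 1 + ‖x - z‖ ≤ (1 / r + 1) * ‖x - z‖ := by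
    have : 1 ≤ 1 / r * ‖x - z‖ := by rwa [one_div, ← div_eq_inv_mul, one_le_div hr]
    linarith
  calc ‖‖x - z‖ ^ (-p)‖
      = (1 / r + 1) ^ p * ((1 / r + 1) * ‖x - z‖) ^ (-p) := by
        rw [Real.norm_of_nonneg (by positivity), Real.mul_rpow (by positivity) (by positivity),
          ← mul_assoc, ← Real.rpow_add (by positivity), add_neg_cancel, Real.rpow_zero, one_mul]
    _ ≤ (1 / r + 1) ^ p * (1 + ‖x - z‖) ^ (-p) := by
        gcongr ?_ * ?_
        exact Real.rpow_le_rpow_of_nonpos (by positivity) hle (by linarith)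

lemma integrableOn_pow_mul_norm_rpow_ball [Nontrivial E] (k : ℕ) (hk : p < finrank ℝ E + k)
    (r : ℝ) : IntegrableOn (fun z : E => ‖z‖ ^ k * ‖z‖ ^ (-p)) (ball 0 r) := by
  refine integrableOn_ball_of_norm_le_rpow (C := 1) (α := p - k) finrank_pos
    (by linarith) ?_ (Measurable.aestronglyMeasurable (by fun_prop))
  have hne : ∀ᵐ z : E, z ≠ 0 := by simp [ae_iff]
  refine ae_restrict_of_ae (hne.mono fun z hz => ?_)
  rw [Real.norm_of_nonneg (by positivity), one_mul, neg_sub, sub_eq_add_neg,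
    Real.rpow_add (norm_pos_iff.2 hz), Real.rpow_natCast]

end Kernel

section PrincipalValue

/-- The truncation `∫_{|x - z| ≥ ε} G(u(x) - u(z)) |x - z|^{-p} dz` of the singular integral,
without the normalizing constant; on `ℝⁿ` the exponent is `p = n + α`. -/
noncomputable def tailIntegral {E : Type*} [NormedAddCommGroup E] [MeasureSpace E] (G : ℝ → ℝ)
    (p : ℝ) (u : E → ℝ) (x : E) (ε : ℝ) : ℝ :=
  ∫ z in (ball x ε)ᶜ, G (u x - u z) * ‖x - z‖ ^ (-p)

/-- The singular integral of `G(u(x) - u(z)) |x - z|^{-p}` exists at `x` as a Cauchy principal value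
with absolutely convergent truncations, and equals `y`. -/
structure HasPV {E : Type*} [NormedAddCommGroup E] [MeasureSpace E] (G : ℝ → ℝ) (p : ℝ)
    (u : E → ℝ) (x : E) (y : ℝ) : Prop where
  integrableOn : ∀ ε, 0 < ε → IntegrableOn (fun z => G (u x - u z) * ‖x - z‖ ^ (-p)) (ball x ε)ᶜ
  tendsto : Tendsto (tailIntegral G p u x) (𝓝[>] 0) (𝓝 y)

lemma normConst_pos (n : ℕ) {α : ℝ} (hα0 : 0 < α) (hα2 : α < 2) : 0 < normConst n α := by
  have : 0 < Real.Gamma (((n : ℝ) + α) / 2) := Real.Gamma_pos_of_pos (by positivity)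
  have h2 : 0 < Real.Gamma (1 - α / 2) := Real.Gamma_pos_of_pos (by linarith)
  have := Real.pi_pos
  unfold normConst
  positivity

lemma HasFAlpha.hasPV {n : ℕ} {G : ℝ → ℝ} {α : ℝ} (hα0 : 0 < α) (hα2 : α < 2)
    {u : EuclideanSpace ℝ (Fin n) → ℝ} {x : EuclideanSpace ℝ (Fin n)} {y : ℝ}
    (h : HasFAlpha G α u x y) : HasPV G (n + α) u x ((normConst n α)⁻¹ * y) := by
  have hkernel : ∀ z, G (u x - u z) / ‖x - z‖ ^ ((n : ℝ) + α)
      = G (u x - u z) * ‖x - z‖ ^ (-((n : ℝ) + α)) := fun z => by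
    rw [Real.rpow_neg (norm_nonneg _), div_eq_mul_inv]
  refine ⟨fun ε hε => by simpa only [hkernel] using h.1 ε hε,
    (h.2.const_mul (normConst n α)⁻¹).congr fun ε => ?_⟩
  rw [truncatedF, inv_mul_cancel_left₀ (normConst_pos n hα0 hα2).ne', tailIntegral]
  simp only [hkernel]

end PrincipalValue

section PairedComparison

variable {E : Type*} [NormedAddCommGroup E] [InnerProductSpace ℝ E] {e x y : E} {l a b c₀ p : ℝ}
  {G : ℝ → ℝ} {u : E → ℝ}

/-- `x` is a point of the half space `⟪e, y⟫ < l` at which `u ∘ mirror e l - u` attains a negative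
minimum over that half space. -/
structure IsNegReflectionMin (e : E) (l : ℝ) (u : E → ℝ) (x : E) : Prop where
  inner_lt : ⟪e, x⟫ < l
  lt : u (mirror e l x) < u x
  le : ∀ y ∈ below e l, u (mirror e l x) - u x ≤ u (mirror e l y) - u y

/-- The integrand of the difference of the singular integrals of `u` at `x` and at `mirror e l x`,
the second one being pulled back to `x` by the mirror. -/
noncomputable def differenceIntegrand (G : ℝ → ℝ) (p : ℝ) (e : E) (l : ℝ) (u : E → ℝ) (x y : E) :
    ℝ :=
  (G (u x - u y) - G (u (mirror e l x) - u (mirror e l y))) * ‖x - y‖ ^ (-p)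

/-- The joint contribution of `y` and `mirror e l y` to the difference of the singular integrals of
`u` at `x` and at `mirror e l x`. -/
noncomputable def pairedIntegrand (G : ℝ → ℝ) (p : ℝ) (e : E) (l : ℝ) (u : E → ℝ) (x y : E) : ℝ :=
  differenceIntegrand G p e l u x y + differenceIntegrand G p e l u x (mirror e l y)

lemma mul_sub_le_sub_of_monotone (hG : Monotone fun t => G t - c₀ * t) {s t : ℝ} (hst : s ≤ t) :
    c₀ * (t - s) ≤ G t - G s := by
  have := hG hst
  simp only at this
  linarith

lemma monotone_of_monotone_sub_mul (hc₀ : 0 ≤ c₀) (hG : Monotone fun t => G t - c₀ * t) :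
    Monotone G := fun _ _ hst =>
  sub_nonneg.1 ((mul_nonneg hc₀ (sub_nonneg.2 hst)).trans (mul_sub_le_sub_of_monotone hG hst))

lemma norm_sub_mirror_rpow_le (he : ‖e‖ = 1) (hp : 0 ≤ p) (hx : ⟪e, x⟫ ≤ l) (hy : ⟪e, y⟫ ≤ l)
    (hyx : y ≠ x) : ‖x - mirror e l y‖ ^ (-p) ≤ ‖x - y‖ ^ (-p) :=
  Real.rpow_le_rpow_of_nonpos (norm_pos_iff.2 (sub_ne_zero.2 hyx.symm))
    (norm_sub_le_norm_sub_mirror he hx hy) (neg_nonpos.2 hp)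

lemma le_pairedIntegrand (he : ‖e‖ = 1) (hp : 0 ≤ p) (hG : Monotone fun t => G t - c₀ * t)
    (hx : IsNegReflectionMin e l u x) (hy : y ∈ below e l) :
    c₀ * ((u (mirror e l y) - u y) + (u x - u (mirror e l x))) *
        (‖x - y‖ ^ (-p) - ‖x - mirror e l y‖ ^ (-p)) +
      2 * c₀ * (u x - u (mirror e l x)) * ‖x - mirror e l y‖ ^ (-p) ≤
    pairedIntegrand G p e l u x y := by
  have hlt := hx.lt
  have hmin := hx.le y hy
  have hk' : 0 ≤ ‖x - mirror e l y‖ ^ (-p) := by positivity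
  have h₁ := mul_sub_le_sub_of_monotone hG
    (show u (mirror e l x) - u (mirror e l y) ≤ u x - u y by linarith)
  have h₂ := mul_sub_le_sub_of_monotone hG
    (show u (mirror e l x) - u y ≤ u x - u y by linarith)
  have h₃ := mul_sub_le_sub_of_monotone hG
    (show u (mirror e l x) - u (mirror e l y) ≤ u x - u (mirror e l y) by linarith)
  have hcross := mul_le_mul_of_nonneg_right (add_le_add h₂ h₃) hk'
  simp only [pairedIntegrand, differenceIntegrand, mirror_mirror he]
  obtain rfl | hyx := eq_or_ne y x
  · simp only [sub_self] at hcross ⊢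
    linarith
  · have hdirect := mul_le_mul_of_nonneg_right h₁
      (sub_nonneg.2 (norm_sub_mirror_rpow_le he hp hx.inner_lt.le hy.le hyx))
    linarith

lemma mul_gap_nonneg (he : ‖e‖ = 1) (hp : 0 ≤ p) (hx : IsNegReflectionMin e l u x)
    (hy : y ∈ below e l) :
    0 ≤ ((u (mirror e l y) - u y) + (u x - u (mirror e l x))) *
      (‖x - y‖ ^ (-p) - ‖x - mirror e l y‖ ^ (-p)) := by
  obtain rfl | hyx := eq_or_ne y x
  · simp
  · exact mul_nonneg (by linarith [hx.le y hy])
      (sub_nonneg.2 (norm_sub_mirror_rpow_le he hp hx.inner_lt.le hy.le hyx))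

lemma pairedIntegrand_nonneg (he : ‖e‖ = 1) (hp : 0 ≤ p) (hc₀ : 0 ≤ c₀)
    (hG : Monotone fun t => G t - c₀ * t) (hx : IsNegReflectionMin e l u x)
    (hy : y ∈ below e l) : 0 ≤ pairedIntegrand G p e l u x y := by
  refine le_trans ?_ (le_pairedIntegrand he hp hG hx hy)
  rw [mul_assoc c₀]
  have := mul_gap_nonneg he hp hx hy
  have := sub_nonneg.2 hx.lt.le
  positivity

lemma preimage_mirror_compl_ball (ε : ℝ) :
    mirror e l ⁻¹' (ball (mirror e l x) ε)ᶜ = (ball x ε)ᶜ := by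
  rw [Set.preimage_compl, IsometryEquiv.preimage_ball, IsometryEquiv.symm_apply_apply]

variable [FiniteDimensional ℝ E] [MeasurableSpace E] [BorelSpace E]

lemma tailIntegral_mirror (ε : ℝ) :
    tailIntegral G p u (mirror e l x) ε =
      ∫ y in (ball x ε)ᶜ, G (u (mirror e l x) - u (mirror e l y)) * ‖x - y‖ ^ (-p) := by
  rw [← preimage_mirror_compl_ball (e := e) (l := l), tailIntegral,
    ← measurePreserving_mirror.setIntegral_preimage_emb (measurableEmbedding_mirror (e := e)
      (l := l))]
  simp only [norm_mirror_sub_mirror]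

lemma HasPV.integrableOn_mirror (hb : HasPV G p u (mirror e l x) b) {ε : ℝ} (hε : 0 < ε) :
    IntegrableOn (fun y => G (u (mirror e l x) - u (mirror e l y)) * ‖x - y‖ ^ (-p))
      (ball x ε)ᶜ := by
  have := (measurePreserving_mirror.integrableOn_comp_preimage
    (measurableEmbedding_mirror (e := e) (l := l))).2 (hb.integrableOn ε hε)
  rw [preimage_mirror_compl_ball] at this
  simpa only [Function.comp_def, norm_mirror_sub_mirror] using this

lemma HasPV.integrableOn_differenceIntegrand (ha : HasPV G p u x a)
    (hb : HasPV G p u (mirror e l x) b) {ε : ℝ} (hε : 0 < ε) :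
    IntegrableOn (differenceIntegrand G p e l u x) (ball x ε)ᶜ := by
  refine ((ha.integrableOn ε hε).sub (hb.integrableOn_mirror hε)).congr_fun (fun y _ => ?_)
    measurableSet_ball.compl
  exact (sub_mul _ _ _).symm

lemma HasPV.integrableOn_differenceIntegrand_mirror (he : ‖e‖ = 1) (hx : ⟪e, x⟫ < l)
    (ha : HasPV G p u x a) (hb : HasPV G p u (mirror e l x) b) :
    IntegrableOn (fun y => differenceIntegrand G p e l u x (mirror e l y)) (below e l) :=
  integrableOn_comp_mirror he <| (ha.integrableOn_differenceIntegrand hb (sub_pos.2 hx)).mono_set <|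
    Set.compl_subset_compl.2 (ball_subset_below he le_rfl)

lemma HasPV.setIntegral_differenceIntegrand (he : ‖e‖ = 1) (ha : HasPV G p u x a)
    (hb : HasPV G p u (mirror e l x) b) {ε : ℝ} (hε : 0 < ε) (hεl : ε ≤ l - ⟪e, x⟫) :
    ∫ y in below e l \ ball x ε, differenceIntegrand G p e l u x y =
      tailIntegral G p u x ε - tailIntegral G p u (mirror e l x) ε -
        ∫ y in below e l, differenceIntegrand G p e l u x (mirror e l y) := by
  rw [eq_sub_iff_add_eq, ← setIntegral_compl_eq_add he (ball_subset_below he hεl)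
    (ha.integrableOn_differenceIntegrand hb hε), tailIntegral_mirror, tailIntegral,
    ← integral_sub (ha.integrableOn ε hε) (hb.integrableOn_mirror hε)]
  simp only [differenceIntegrand, sub_mul]

lemma aecover_sdiff_ball [Nontrivial E] (s : Set E) (x : E) {ι : Type*} {L : Filter ι} {ε : ι → ℝ}
    (hε : Tendsto ε L (𝓝 0)) : AECover (volume.restrict s) L fun i => (ball x (ε i))ᶜ where
  ae_eventually_mem := by
    have hne : ∀ᵐ y : E, y ≠ x := by simp [ae_iff]
    filter_upwards [ae_restrict_of_ae hne] with y hy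
    filter_upwards [hε.eventually_lt_const (dist_pos.2 hy)] with i hi
    simpa using hi.le
  measurableSet _ := measurableSet_ball.compl

lemma HasPV.integral_pairedIntegrand (he : ‖e‖ = 1) (hp : 0 ≤ p) (hc₀ : 0 ≤ c₀)
    (hG : Monotone fun t => G t - c₀ * t) (hx : IsNegReflectionMin e l u x)
    (ha : HasPV G p u x a) (hb : HasPV G p u (mirror e l x) b) :
    IntegrableOn (pairedIntegrand G p e l u x) (below e l) ∧
      ∫ y in below e l, pairedIntegrand G p e l u x y = a - b := by
  have : Nontrivial E := nontrivial_of_ne e 0 (norm_ne_zero_iff.1 (he ▸ one_ne_zero))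
  obtain ⟨ε, -, hε, hε0⟩ := exists_seq_strictAnti_tendsto' (sub_pos.2 hx.inner_lt)
  have hε0' : Tendsto ε atTop (𝓝[>] 0) :=
    tendsto_nhdsWithin_of_tendsto_nhds_of_eventually_within _ hε0 (.of_forall fun i => (hε i).1)
  have hcover := aecover_sdiff_ball (below e l) x hε0
  have hrestrict : ∀ i, (volume.restrict (below e l)).restrict (ball x (ε i))ᶜ =
      volume.restrict (below e l \ ball x (ε i)) := fun i => by
    rw [Measure.restrict_restrict measurableSet_ball.compl, Set.inter_comm, Set.sdiff_eq]
  have hmirror := ha.integrableOn_differenceIntegrand_mirror he hx.inner_lt hb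
  have hdirect : ∀ i, IntegrableOn (differenceIntegrand G p e l u x) (ball x (ε i))ᶜ
      (volume.restrict (below e l)) := fun i => by
    rw [IntegrableOn, hrestrict]
    exact (ha.integrableOn_differenceIntegrand hb (hε i).1).mono_set fun y hy => hy.2
  have hint : ∀ i, IntegrableOn (pairedIntegrand G p e l u x) (ball x (ε i))ᶜ
      (volume.restrict (below e l)) := fun i => (hdirect i).add hmirror.integrableOn
  have hnonneg : 0 ≤ᵐ[volume.restrict (below e l)] pairedIntegrand G p e l u x :=
    (ae_restrict_mem measurableSet_below).mono fun y hy =>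
      pairedIntegrand_nonneg he hp hc₀ hG hx hy
  have hlim : Tendsto (fun i => ∫ y in (ball x (ε i))ᶜ, pairedIntegrand G p e l u x y
      ∂volume.restrict (below e l)) atTop (𝓝 (a - b)) := by
    have htail := ((ha.tendsto.comp hε0').sub (hb.tendsto.comp hε0')).sub_const
      (∫ y in below e l, differenceIntegrand G p e l u x (mirror e l y))
    refine ((htail.add (hcover.integral_tendsto_of_countably_generated hmirror)).congr
      fun i => ?_).trans_eq (by rw [sub_add_cancel])
    simp only [Function.comp_apply,
      ← ha.setIntegral_differenceIntegrand he hb (hε i).1 (hε i).2.le, ← hrestrict]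
    exact (integral_add (hdirect i) hmirror.integrableOn).symm
  exact ⟨hcover.integrable_of_integral_tendsto_of_nonneg_ae _ hint hnonneg hlim,
    hcover.integral_eq_of_tendsto_of_nonneg_ae _ hnonneg hint hlim⟩

end PairedComparison

section ReflectionEstimates

variable {E : Type*} [NormedAddCommGroup E] [InnerProductSpace ℝ E] {e x : E} {l a b c₀ p : ℝ}
  {G : ℝ → ℝ} {u : E → ℝ}

lemma mul_one_sub_rpow_le_sub {s t θ L : ℝ} (hp : 0 ≤ p) (hs : 0 < s) (hsL : s ≤ L) (hθ : 1 ≤ θ)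
    (hst : θ * s ≤ t) : L ^ (-p) * (1 - θ ^ (-p)) ≤ s ^ (-p) - t ^ (-p) := by
  have hθp : θ ^ (-p) ≤ 1 := Real.rpow_le_one_of_one_le_of_nonpos hθ (neg_nonpos.2 hp)
  have hL : L ^ (-p) ≤ s ^ (-p) := Real.rpow_le_rpow_of_nonpos hs hsL (neg_nonpos.2 hp)
  have ht : t ^ (-p) ≤ (θ * s) ^ (-p) :=
    Real.rpow_le_rpow_of_nonpos (by positivity) hst (neg_nonpos.2 hp)
  rw [Real.mul_rpow (by positivity) hs.le] at ht
  linarith [mul_le_mul_of_nonneg_right hL (sub_nonneg.2 hθp)]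

lemma exists_pos_le_norm_rpow_gap (he : ‖e‖ = 1) (hp : 0 < p) {δ L : ℝ} (hδ : 0 < δ) (hL : 0 < L) :
    ∃ k₀ > 0, ∀ (l : ℝ) (x y : E), δ ≤ l - ⟪e, x⟫ → 1 ≤ l - ⟪e, y⟫ → ‖x - y‖ ≤ L → y ≠ x →
      k₀ ≤ ‖x - y‖ ^ (-p) - ‖x - mirror e l y‖ ^ (-p) := by
  set θ := √(1 + 4 * δ / L ^ 2) with hθ
  have hθ1 : 1 < θ := by
    rw [hθ, Real.lt_sqrt zero_le_one]
    linarith [show 0 < 4 * δ / L ^ 2 by positivity]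
  refine ⟨L ^ (-p) * (1 - θ ^ (-p)), mul_pos (by positivity)
    (sub_pos.2 (Real.rpow_lt_one_of_one_lt_of_neg hθ1 (neg_lt_zero.2 hp))), ?_⟩
  intro l x y hx hy hxy hyx
  refine mul_one_sub_rpow_le_sub hp.le (norm_pos_iff.2 (sub_ne_zero.2 hyx.symm)) hxy hθ1.le ?_
  refine le_of_sq_le_sq ?_ (norm_nonneg _)
  have hscale : 4 * δ / L ^ 2 * ‖x - y‖ ^ 2 ≤ 4 * δ := by
    rw [div_mul_eq_mul_div, div_le_iff₀ (by positivity)]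
    gcongr
  have hprod : δ * 1 ≤ (l - ⟪e, x⟫) * (l - ⟪e, y⟫) :=
    mul_le_mul hx hy zero_le_one (hδ.le.trans hx)
  rw [mul_pow, Real.sq_sqrt (by positivity), norm_sub_mirror_sq he]
  linarith

variable [FiniteDimensional ℝ E] [MeasurableSpace E] [BorelSpace E]

variable (he : ‖e‖ = 1) (hp : 0 ≤ p) (hc₀ : 0 ≤ c₀) (hG : Monotone fun t => G t - c₀ * t)
  (hx : IsNegReflectionMin e l u x) (ha : HasPV G p u x a) (hb : HasPV G p u (mirror e l x) b)

include he hp hc₀ hG hx ha hb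

lemma HasPV.setIntegral_le_sub {S : Set E} (hS : MeasurableSet S)
    (hSl : S ⊆ below e l) {g : E → ℝ} (hg : IntegrableOn g S)
    (hle : ∀ y ∈ S, g y ≤ pairedIntegrand G p e l u x y) : ∫ y in S, g y ≤ a - b := by
  obtain ⟨hint, heq⟩ := ha.integral_pairedIntegrand he hp hc₀ hG hx hb
  rw [← heq]
  refine (setIntegral_mono_on hg (hint.mono_set hSl) hS hle).trans
    (setIntegral_mono_set hint ?_ hSl.eventuallyLE)
  exact (ae_restrict_mem measurableSet_below).mono fun y hy =>
    pairedIntegrand_nonneg he hp hc₀ hG hx hy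

lemma HasPV.mul_rpow_mul_volume_le_sub :
    2 * c₀ * (u x - u (mirror e l x)) * (3 * (l - ⟪e, x⟫)) ^ (-p) *
      volume.real (ball x (l - ⟪e, x⟫)) ≤ a - b := by
  have hball : ball x (l - ⟪e, x⟫) ⊆ below e l := ball_subset_below he le_rfl
  have hbound := ha.setIntegral_le_sub he hp hc₀ hG hx hb measurableSet_ball hball
    (integrableOn_const measure_ball_lt_top.ne) (g := fun _ => 2 * c₀ * (u x - u (mirror e l x)) *
      (3 * (l - ⟪e, x⟫)) ^ (-p)) fun y hy => ?_
  · rwa [setIntegral_const, smul_eq_mul, mul_comm] at hbound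
  refine le_trans ?_ (le_pairedIntegrand he hp hG hx (hball hy))
  have hnorm : ‖x - mirror e l y‖ ≤ 3 * (l - ⟪e, x⟫) := by
    rw [mem_ball_iff_norm'] at hy
    calc ‖x - mirror e l y‖ ≤ ‖x - mirror e l x‖ + ‖mirror e l x - mirror e l y‖ :=
          norm_sub_le_norm_sub_add_norm_sub _ _ _
      _ ≤ 3 * (l - ⟪e, x⟫) := by
          rw [norm_sub_mirror_self he hx.inner_lt.le, norm_mirror_sub_mirror]
          linarith
  have hpos : 0 < ‖x - mirror e l y‖ :=
    (norm_nonneg _).lt_of_ne' fun h => ?_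
  · have hd := sub_nonneg.2 hx.lt.le
    rw [mul_assoc c₀]
    refine le_add_of_nonneg_of_le (mul_nonneg hc₀ (mul_gap_nonneg he hp hx (hball hy))) ?_
    gcongr 2 * c₀ * (u x - u (mirror e l x)) * ?_
    exact Real.rpow_le_rpow_of_nonpos hpos hnorm (neg_nonpos.2 hp)
  · have hxy := congrArg (fun z => ⟪e, z⟫) (sub_eq_zero.1 (norm_eq_zero.1 h))
    simp only [inner_mirror he] at hxy
    linarith [hx.inner_lt, mem_below.1 (hball hy)]

lemma HasPV.mul_setIntegral_ball_le_sub (hu : Continuous u) {q : E} {r k₀ : ℝ}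
    (hball : ball q r ⊆ below e l) (hgap : ∀ y ∈ ball q r, y ≠ x →
      k₀ ≤ ‖x - y‖ ^ (-p) - ‖x - mirror e l y‖ ^ (-p)) :
    c₀ * k₀ * ∫ y in ball q r, ((u (mirror e l y) - u y) + (u x - u (mirror e l x))) ≤ a - b := by
  have hcont : Continuous fun y => (u (mirror e l y) - u y) + (u x - u (mirror e l x)) :=
    ((hu.comp (mirror e l).continuous).sub hu).add_const _
  have hint := integrableOn_ball_of_continuous (μ := volume) hcont q r
  rw [← integral_const_mul]
  refine ha.setIntegral_le_sub he hp hc₀ hG hx hb measurableSet_ball hball (hint.const_mul _)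
    fun y hy => (?_ : _ ≤ _).trans (le_pairedIntegrand he hp hG hx (hball hy))
  have hd := sub_nonneg.2 hx.lt.le
  refine le_add_of_le_of_nonneg ?_ (by positivity)
  obtain rfl | hyx := eq_or_ne y x
  · simp
  rw [mul_right_comm]
  exact mul_le_mul_of_nonneg_left (hgap y hy hyx)
    (mul_nonneg hc₀ (by linarith [hx.le y (hball hy)]))

lemma HasPV.mul_setIntegral_ball_self_le_sub (hu : Continuous u) {ρ : ℝ}
    (hρ : 0 ≤ ρ) (hρl : 2 * ρ ≤ l - ⟪e, x⟫) :
    c₀ * (ρ ^ (-p) * (1 - 2 ^ (-p))) *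
      ∫ y in ball x ρ, ((u (mirror e l y) - u y) + (u x - u (mirror e l x))) ≤ a - b := by
  refine ha.mul_setIntegral_ball_le_sub he hp hc₀ hG hx hb hu
    (ball_subset_below he (by linarith)) fun y hy hyx => ?_
  rw [mem_ball_iff_norm'] at hy
  refine mul_one_sub_rpow_le_sub hp (norm_pos_iff.2 (sub_ne_zero.2 hyx.symm)) hy.le one_le_two ?_
  have htri : ‖x - mirror e l x‖ ≤ ‖x - mirror e l y‖ + ‖mirror e l y - mirror e l x‖ :=
    norm_sub_le_norm_sub_add_norm_sub _ _ _
  rw [norm_sub_mirror_self he hx.inner_lt.le, norm_mirror_sub_mirror, norm_sub_rev y] at htri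
  linarith

end ReflectionEstimates

section Annulus

variable {E : Type*} [NormedAddCommGroup E] [InnerProductSpace ℝ E] [FiniteDimensional ℝ E]
  [MeasurableSpace E] [BorelSpace E] {G : ℝ → ℝ} {p ε r : ℝ} {f g : E → ℝ}

/-- The part of a singular integral coming from the annulus `ε ≤ |ζ| < r`, where `f ζ` is the
increment of the function at distance `ζ` from the singularity. -/
noncomputable def annulusIntegral (G : ℝ → ℝ) (p ε r : ℝ) (f : E → ℝ) : ℝ :=
  ∫ ζ in ball 0 r \ ball 0 ε, G (f ζ) * ‖ζ‖ ^ (-p)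

lemma integrableOn_mul_norm_rpow_annulus (hf : Continuous f) (hε : 0 < ε) :
    IntegrableOn (fun ζ => f ζ * ‖ζ‖ ^ (-p)) (ball 0 r \ ball 0 ε) := by
  refine IntegrableOn.mono_set (ContinuousOn.integrableOn_compact
    ((isCompact_closedBall (0 : E) r).diff (isOpen_ball (x := 0) (ε := ε))) ?_)
    (Set.sdiff_subset_sdiff_left ball_subset_closedBall)
  refine hf.continuousOn.mul (continuous_norm.continuousOn.rpow_const fun ζ hζ => Or.inl ?_)
  exact (hε.trans_le (by simpa using hζ.2)).ne'

lemma integrableOn_annulusIntegrand (hG : Continuous G) (hf : Continuous f) (hε : 0 < ε) :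
    IntegrableOn (fun ζ => G (f ζ) * ‖ζ‖ ^ (-p)) (ball 0 r \ ball 0 ε) :=
  integrableOn_mul_norm_rpow_annulus (hG.comp hf) hε

lemma HasPV.tailIntegral_eq_add {u : E → ℝ} {x : E} {y : ℝ} (h : HasPV G p u x y) (hε : 0 < ε)
    (hεr : ε ≤ r) : tailIntegral G p u x ε =
      annulusIntegral G p ε r (fun ζ => u x - u (x + ζ)) + tailIntegral G p u x r := by
  have hsplit : (ball x ε)ᶜ = (ball x r \ ball x ε) ∪ (ball x r)ᶜ := by
    ext y
    have := @ball_subset_ball _ _ x _ _ hεr y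
    simp only [Set.mem_compl_iff, Set.mem_union, Set.mem_sdiff]
    tauto
  have hpre : (fun ζ => x + ζ) ⁻¹' (ball x r \ ball x ε) = ball 0 r \ ball 0 ε := by
    simp [Set.preimage_sdiff]
  have htranslate : ∫ z in ball x r \ ball x ε, G (u x - u z) * ‖x - z‖ ^ (-p) =
      annulusIntegral G p ε r fun ζ => u x - u (x + ζ) := by
    rw [← (measurePreserving_add_left volume x).setIntegral_preimage_emb
      (measurableEmbedding_addLeft x), hpre, annulusIntegral]
    simp only [sub_add_cancel_left, norm_neg]
  rw [← htranslate, tailIntegral, tailIntegral, hsplit, setIntegral_union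
    (Set.disjoint_compl_right_iff_subset.2 Set.sdiff_subset) measurableSet_ball.compl
    ((h.integrableOn ε hε).mono_set fun y hy => hy.2) (h.integrableOn r (hε.trans_le hεr))]

lemma setIntegral_annulus_pow_mul_le [Nontrivial E] (k : ℕ) (hk : p < finrank ℝ E + k)
    (hr : r ≤ 1) : ∫ ζ in (ball 0 r \ ball 0 ε : Set E), ‖ζ‖ ^ k * ‖ζ‖ ^ (-p) ≤
      ∫ ζ in ball (0 : E) 1, ‖ζ‖ ^ k * ‖ζ‖ ^ (-p) :=
  setIntegral_mono_set (integrableOn_pow_mul_norm_rpow_ball k hk 1)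
    (.of_forall fun ζ => by positivity)
    (Set.sdiff_subset.trans (ball_subset_ball hr)).eventuallyLE

lemma annulusIntegral_le_add [Nontrivial E] (hp : p < finrank ℝ E + 2) (hG : Continuous G)
    (hGm : Monotone G) {M : ℝ} {C : NNReal} (hC : LipschitzOnWith C G (Set.Icc (-M) M))
    (hf : Continuous f) (hg : Continuous g) {κ : ℝ} (hκ : 0 ≤ κ)
    (hfg : ∀ ζ ∈ ball (0 : E) 1, f ζ ≤ g ζ + κ * ‖ζ‖ ^ 2)
    (hgM : ∀ ζ ∈ ball (0 : E) 1, |g ζ| + κ ≤ M) (hε : 0 < ε) (hr : r ≤ 1) :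
    annulusIntegral G p ε r f ≤ annulusIntegral G p ε r g +
      C * κ * ∫ ζ in ball (0 : E) 1, ‖ζ‖ ^ 2 * ‖ζ‖ ^ (-p) := by
  have hpoint : ∀ ζ ∈ ball (0 : E) 1, G (f ζ) ≤ G (g ζ) + C * κ * ‖ζ‖ ^ 2 := fun ζ hζ => by
    have hκζ : κ * ‖ζ‖ ^ 2 ≤ κ := mul_le_of_le_one_right hκ
      (pow_le_one₀ (norm_nonneg _) (mem_ball_zero_iff.1 hζ).le)
    have hM := hgM ζ hζ
    have hκζ0 : 0 ≤ κ * ‖ζ‖ ^ 2 := by positivity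
    have hlip := hC.dist_le_mul (g ζ + κ * ‖ζ‖ ^ 2)
      ⟨by linarith [neg_abs_le (g ζ)], by linarith [le_abs_self (g ζ)]⟩ (g ζ)
      ⟨by linarith [neg_abs_le (g ζ)], by linarith [le_abs_self (g ζ)]⟩
    rw [Real.dist_eq, Real.dist_eq, add_sub_cancel_left, abs_of_nonneg hκζ0] at hlip
    linarith [hGm (hfg ζ hζ), le_abs_self (G (g ζ + κ * ‖ζ‖ ^ 2) - G (g ζ))]
  have hquad : IntegrableOn (fun ζ : E => C * κ * (‖ζ‖ ^ 2 * ‖ζ‖ ^ (-p))) (ball 0 r \ ball 0 ε) :=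
    (integrableOn_mul_norm_rpow_annulus (by fun_prop) hε).const_mul _
  have hgint := integrableOn_annulusIntegrand (p := p) (r := r) hG hg hε
  calc annulusIntegral G p ε r f
      ≤ ∫ ζ in ball 0 r \ ball 0 ε, (G (g ζ) * ‖ζ‖ ^ (-p) + C * κ * (‖ζ‖ ^ 2 * ‖ζ‖ ^ (-p))) := by
        refine setIntegral_mono_on (integrableOn_annulusIntegrand hG hf hε) (hgint.add hquad)
          (measurableSet_ball.diff measurableSet_ball) fun ζ hζ => ?_
        rw [← mul_assoc, ← add_mul]
        gcongr
        exact hpoint ζ (ball_subset_ball hr hζ.1)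
    _ = annulusIntegral G p ε r g +
          C * κ * ∫ ζ in (ball 0 r \ ball 0 ε : Set E), ‖ζ‖ ^ 2 * ‖ζ‖ ^ (-p) := by
        rw [integral_add hgint hquad, integral_const_mul, annulusIntegral]
    _ ≤ _ := by
        gcongr _ + _ * ?_
        exact setIntegral_annulus_pow_mul_le 2 (mod_cast hp) hr

lemma annulusIntegral_inner_congr {v w : E} (h : ‖v‖ = ‖w‖) :
    annulusIntegral G p ε r (fun ζ => ⟪v, ζ⟫) = annulusIntegral G p ε r (fun ζ => ⟪w, ζ⟫) := by
  set T := Submodule.reflection (ℝ ∙ (v - w))ᗮ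
  have hT : T v = w := Submodule.reflection_sub h
  have hpre : T ⁻¹' (ball 0 r \ ball 0 ε) = ball 0 r \ ball 0 ε := by
    ext ζ
    simp
  simp only [annulusIntegral, ← hT]
  conv_rhs => rw [← T.measurePreserving.setIntegral_preimage_emb
    T.toHomeomorph.measurableEmbedding, hpre]
  simp only [T.inner_map_map, T.norm_map]

lemma annulusIntegral_inner_smul {t : ℝ} (ht : 0 < t) (v : E) :
    annulusIntegral G p ε r (fun ζ => ⟪t • v, ζ⟫) =
      t ^ (p - finrank ℝ E) * annulusIntegral G p (t * ε) (t * r) (fun ζ => ⟪v, ζ⟫) := by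
  have hscale := Measure.setIntegral_comp_smul_of_pos volume
    (fun ζ : E => G ⟪v, ζ⟫ * ‖ζ‖ ^ (-p)) (ball 0 r \ ball 0 ε) ht
  rw [Set.smul_set_sdiff₀ ht.ne', _root_.smul_ball ht.ne', _root_.smul_ball ht.ne', smul_zero,
    Real.norm_of_nonneg ht.le] at hscale
  have hintegrand : ∀ ζ : E, G ⟪t • v, ζ⟫ * ‖ζ‖ ^ (-p) =
      t ^ p * (G ⟪v, t • ζ⟫ * ‖t • ζ‖ ^ (-p)) := fun ζ => by
    rw [real_inner_smul_left, real_inner_smul_right, norm_smul, Real.norm_of_nonneg ht.le,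
      Real.mul_rpow ht.le (norm_nonneg _), Real.rpow_neg ht.le]
    field_simp
  simp only [annulusIntegral, hintegrand]
  rw [integral_const_mul, hscale, smul_eq_mul, ← mul_assoc, Real.rpow_sub ht, Real.rpow_natCast,
    div_eq_mul_inv]

end Annulus

section TouchingFromAbove

variable {E : Type*} [NormedAddCommGroup E] [InnerProductSpace ℝ E] {u : E → ℝ} {x₀ : E}

lemma exists_sq_norm_sub_lt_sub [Nontrivial E] (hu₀ : Tendsto u (cocompact E) (𝓝 0))
    (hx₀ : u x₀ ≠ 0) : ∃ y z, ‖y - z‖ ^ 2 < u y - u z := by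
  by_contra! h
  have hderiv : ∀ x, HasFDerivAt u (0 : E →L[ℝ] ℝ) x := fun x => by
    refine .of_isLittleO (Asymptotics.IsBigO.trans_isLittleO (.of_norm_le fun y => ?_)
      (Asymptotics.isLittleO_pow_sub_sub x one_lt_two))
    rw [zero_apply, sub_zero, Real.norm_eq_abs, abs_le]
    exact ⟨by linarith [norm_sub_rev x y ▸ h x y], h y x⟩
  have hconst : ∀ y, u y = u x₀ := fun y => is_const_of_fderiv_eq_zero
    (fun x => (hderiv x).differentiableAt) (fun x => (hderiv x).fderiv) y x₀
  exact hx₀ (tendsto_nhds_unique (tendsto_const_nhds.congr fun y => (hconst y).symm) hu₀)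

variable [FiniteDimensional ℝ E]

lemma exists_inner_le_sub_add_sq [Nontrivial E] (hu : Continuous u) (hu_nonneg : ∀ y, 0 ≤ u y)
    (hu₀ : Tendsto u (cocompact E) (𝓝 0)) (hx₀ : u x₀ ≠ 0) :
    ∃ x v : E, 0 < u x ∧ v ≠ 0 ∧ ∀ ζ, ⟪v, ζ⟫ ≤ u x - u (x + ζ) + ‖ζ‖ ^ 2 := by
  obtain ⟨y, z, hyz⟩ := exists_sq_norm_sub_lt_sub hu₀ hx₀
  have hatBot : Tendsto (fun y => u y - ‖y - z‖ ^ 2) (cocompact E) atBot := by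
    have hnorm : Tendsto (fun y => ‖y - z‖) (cocompact E) atTop :=
      (tendsto_dist_left_cocompact_atTop z).congr fun y => by rw [dist_comm, dist_eq_norm]
    exact hu₀.add_atBot (tendsto_neg_atTop_atBot.comp ((tendsto_pow_atTop two_ne_zero).comp hnorm))
  obtain ⟨x, hx⟩ := (show Continuous fun y => u y - ‖y - z‖ ^ 2 by fun_prop).exists_forall_ge hatBot
  have hzx : u z < u x := by linarith [hx y, sq_nonneg ‖x - z‖]
  refine ⟨x, (-2 : ℝ) • (x - z), (hu_nonneg z).trans_lt hzx, ?_, fun ζ => ?_⟩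
  · simpa [sub_eq_zero] using fun h : x = z => hzx.ne (congrArg u h.symm)
  · have hsq : ‖x + ζ - z‖ ^ 2 = ‖x - z‖ ^ 2 + 2 * ⟪x - z, ζ⟫ + ‖ζ‖ ^ 2 := by
      rw [add_sub_right_comm, norm_add_sq_real]
    rw [real_inner_smul_left]
    linarith [hx (x + ζ)]

end TouchingFromAbove

section GradientBound

variable {E : Type*} [NormedAddCommGroup E] [InnerProductSpace ℝ E] [FiniteDimensional ℝ E]
  [MeasurableSpace E] [BorelSpace E] {G : ℝ → ℝ} {p : ℝ} {u : E → ℝ} {x : E} {y : ℝ}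

lemma exists_lipschitzOnWith_Icc (hG : LocallyLipschitz G) (M : ℝ) :
    ∃ C, LipschitzOnWith C G (Set.Icc (-M) M) :=
  hG.locallyLipschitzOn.exists_lipschitzOnWith_of_compact isCompact_Icc

lemma HasPV.exists_annulusIntegral_inner_le [Nontrivial E] (hp : p < finrank ℝ E + 2)
    (hG : LocallyLipschitz G) (hGm : Monotone G) (hu : Continuous u) (hPV : HasPV G p u x y)
    {v : E} {κ : ℝ} (hκ : 0 ≤ κ) (hv : ∀ ζ, ⟪v, ζ⟫ ≤ u x - u (x + ζ) + κ * ‖ζ‖ ^ 2) :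
    ∃ r₀ > 0, ∃ C, ∀ s s', 0 < s → s ≤ s' → s' ≤ r₀ →
      annulusIntegral G p s s' (fun ζ => ⟪v, ζ⟫) ≤ C := by
  have hincr : Continuous fun ζ => u x - u (x + ζ) := by fun_prop
  obtain ⟨M, hM⟩ := (isCompact_closedBall (0 : E) 1).exists_bound_of_continuousOn hincr.continuousOn
  obtain ⟨L, hL⟩ := exists_lipschitzOnWith_Icc hG (M + κ)
  obtain ⟨r₁, hr₁, htail⟩ := mem_nhdsGT_iff_exists_Ioc_subset.1
    (hPV.tendsto.eventually (Metric.ball_mem_nhds y one_pos))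
  refine ⟨min r₁ 1, lt_min hr₁ one_pos, 2 + L * κ * ∫ ζ in ball (0 : E) 1, ‖ζ‖ ^ 2 * ‖ζ‖ ^ (-p),
    fun s s' hs hss' hs' => ?_⟩
  have hs'r := hs'.trans (min_le_left _ _)
  have hs₁ : |tailIntegral G p u x s - y| < 1 := htail ⟨hs, hss'.trans hs'r⟩
  have hs₂ : |tailIntegral G p u x s' - y| < 1 := htail ⟨hs.trans_le hss', hs'r⟩
  have := annulusIntegral_le_add hp hG.continuous hGm hL (f := fun ζ => ⟪v, ζ⟫) (by fun_prop) hincr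
    hκ (fun ζ _ => hv ζ) (fun ζ hζ => by gcongr; exact hM ζ (ball_subset_closedBall hζ)) hs
    (hs'.trans (min_le_right _ _))
  linarith [hPV.tailIntegral_eq_add hs hss', (abs_lt.1 hs₁).2, (abs_lt.1 hs₂).1]

/-- Over small annuli around the singularity, the singular integral of the linear functions `⟪v, ·⟫`
with `v` in a given ball is at most linear in `‖v‖`, uniformly in the inner radius. -/
def HasGradientBound (E : Type*) [NormedAddCommGroup E] [InnerProductSpace ℝ E]
    [FiniteDimensional ℝ E] [MeasurableSpace E] [BorelSpace E] (G : ℝ → ℝ) (p : ℝ) : Prop :=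
  ∀ P, 0 < P → ∃ r, 0 < r ∧ r ≤ 1 ∧ ∃ C, 0 ≤ C ∧ ∀ v : E, ‖v‖ ≤ P → ∀ ε, 0 < ε → ε ≤ r →
    annulusIntegral G p ε r (fun ζ => ⟪v, ζ⟫) ≤ C * ‖v‖

lemma hasGradientBound_of_lt [Nontrivial E] (hp : p < finrank ℝ E + 1) (hG : LocallyLipschitz G)
    (hG₀ : G 0 = 0) : HasGradientBound E G p := fun P hP => by
  obtain ⟨L, hL⟩ := exists_lipschitzOnWith_Icc hG P
  refine ⟨1, one_pos, le_rfl, L * ∫ ζ in ball (0 : E) 1, ‖ζ‖ ^ 1 * ‖ζ‖ ^ (-p),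
    mul_nonneg L.2 (integral_nonneg fun ζ => by positivity), fun v hv ε hε _ => ?_⟩
  have hlin : ∀ ζ ∈ ball (0 : E) 1 \ ball 0 ε,
      G ⟪v, ζ⟫ * ‖ζ‖ ^ (-p) ≤ L * ‖v‖ * (‖ζ‖ ^ 1 * ‖ζ‖ ^ (-p)) := fun ζ hζ => by
    have hvζ := abs_real_inner_le_norm v ζ
    have hζ1 : ‖v‖ * ‖ζ‖ ≤ P :=
      mul_le_of_le_one_right (norm_nonneg _) (mem_ball_zero_iff.1 hζ.1).le |>.trans hv
    have hlip := hL.dist_le_mul ⟪v, ζ⟫ (abs_le.1 (hvζ.trans hζ1)) 0 ⟨by linarith, hP.le⟩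
    rw [hG₀, dist_zero_right, dist_zero_right, Real.norm_eq_abs, Real.norm_eq_abs] at hlip
    rw [pow_one, ← mul_assoc]
    gcongr
    calc G ⟪v, ζ⟫ ≤ L * |⟪v, ζ⟫| := (le_abs_self _).trans hlip
      _ ≤ L * (‖v‖ * ‖ζ‖) := by gcongr
      _ = L * ‖v‖ * ‖ζ‖ := (mul_assoc _ _ _).symm
  calc annulusIntegral G p ε 1 (fun ζ => ⟪v, ζ⟫)
      ≤ ∫ ζ in ball 0 1 \ ball 0 ε, L * ‖v‖ * (‖ζ‖ ^ 1 * ‖ζ‖ ^ (-p)) :=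
        setIntegral_mono_on (integrableOn_annulusIntegrand hG.continuous (by fun_prop) hε)
          ((integrableOn_mul_norm_rpow_annulus (by fun_prop) hε).const_mul _)
          (measurableSet_ball.diff measurableSet_ball) hlin
    _ ≤ L * ‖v‖ * ∫ ζ in ball (0 : E) 1, ‖ζ‖ ^ 1 * ‖ζ‖ ^ (-p) := by
        rw [integral_const_mul]
        gcongr _ * ?_
        exact setIntegral_annulus_pow_mul_le 1 (mod_cast hp) le_rfl
    _ = _ := mul_right_comm _ _ _

lemma hasGradientBound_of_annulusIntegral_le (hp : finrank ℝ E + 1 ≤ p) (hG₀ : G 0 = 0) {v₀ : E}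
    (hv₀ : v₀ ≠ 0) {r₀ C : ℝ} (hr₀ : 0 < r₀) (hC : ∀ s s', 0 < s → s ≤ s' → s' ≤ r₀ →
      annulusIntegral G p s s' (fun ζ => ⟪v₀, ζ⟫) ≤ C) : HasGradientBound E G p := fun P hP => by
  have hv₀' := norm_pos_iff.2 hv₀
  set T := P / ‖v₀‖
  have hT : 0 < T := div_pos hP hv₀'
  refine ⟨min 1 (r₀ / T), by positivity, min_le_left _ _,
    T ^ (p - finrank ℝ E - 1) / ‖v₀‖ * |C|, by positivity, fun v hv ε hε hεr => ?_⟩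
  obtain rfl | hv0 := eq_or_ne v 0
  · simp [annulusIntegral, hG₀]
  set t := ‖v‖ / ‖v₀‖
  have ht : 0 < t := div_pos (norm_pos_iff.2 hv0) hv₀'
  have htT : t ≤ T := div_le_div_of_nonneg_right hv hv₀'.le
  have hnorm : ‖v‖ = ‖t • v₀‖ := by
    rw [norm_smul, Real.norm_of_nonneg ht.le, div_mul_cancel₀ _ hv₀'.ne']
  have htr : t * min 1 (r₀ / T) ≤ r₀ :=
    calc t * min 1 (r₀ / T) ≤ T * (r₀ / T) := by gcongr; exact min_le_right _ _
      _ = r₀ := mul_div_cancel₀ _ hT.ne'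
  have hpow : t ^ (p - finrank ℝ E) ≤ T ^ (p - finrank ℝ E - 1) * t :=
    calc t ^ (p - finrank ℝ E) = t ^ (p - finrank ℝ E - 1) * t := by
          rw [← Real.rpow_add_one ht.ne', sub_add_cancel]
      _ ≤ _ := by gcongr; linarith
  rw [annulusIntegral_inner_congr hnorm, annulusIntegral_inner_smul ht]
  calc t ^ (p - finrank ℝ E) * annulusIntegral G p (t * ε) (t * min 1 (r₀ / T)) (fun ζ => ⟪v₀, ζ⟫)
      ≤ t ^ (p - finrank ℝ E) * |C| := by
        gcongr
        exact (hC _ _ (by positivity) (by gcongr) htr).trans (le_abs_self C)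
    _ ≤ T ^ (p - finrank ℝ E - 1) * t * |C| := by gcongr
    _ = _ := by ring

lemma hasGradientBound [Nontrivial E] (hp : p < finrank ℝ E + 2) (hG : LocallyLipschitz G)
    (hGm : Monotone G) (hG₀ : G 0 = 0) (hu : Continuous u) (hu_nonneg : ∀ y, 0 ≤ u y)
    (hu₀ : Tendsto u (cocompact E) (𝓝 0)) (hPV : ∀ x, 0 < u x → ∃ y, HasPV G p u x y)
    (hx : u x ≠ 0) : HasGradientBound E G p := by
  obtain hp1 | hp1 := lt_or_ge p (finrank ℝ E + 1)
  · exact hasGradientBound_of_lt hp1 hG hG₀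
  obtain ⟨x₁, v, hx₁, hv, htouch⟩ := exists_inner_le_sub_add_sq hu hu_nonneg hu₀ hx
  obtain ⟨y, hy⟩ := hPV x₁ hx₁
  obtain ⟨r₀, hr₀, C, hC⟩ := hy.exists_annulusIntegral_inner_le hp hG hGm hu zero_le_one
    (by simpa only [one_mul] using htouch)
  exact hasGradientBound_of_annulusIntegral_le hp1 hG₀ hv hr₀ hC

end GradientBound

section WeakHarnack

variable {E : Type*} [NormedAddCommGroup E] [InnerProductSpace ℝ E] [FiniteDimensional ℝ E]
  {u : E → ℝ} {x y z : E}

lemma exists_sub_le_inner_add_sq (hu : Continuous u) (hu_nonneg : ∀ y, 0 ≤ u y) {κ : ℝ}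
    (hκ : 0 ≤ κ) (hy : y ∈ ball z 1) (huy : u y < κ * (1 - ‖y - z‖ ^ 2)) :
    ∃ x ∈ ball z 1, ∃ v : E, ‖v‖ ≤ 2 * κ ∧ u x ≤ κ ∧
      ∀ ζ, u x - u (x + ζ) ≤ ⟪v, ζ⟫ + κ * ‖ζ‖ ^ 2 := by
  obtain ⟨x, -, hxmin⟩ := (isCompact_closedBall z 1).exists_isMinOn
    (nonempty_closedBall.2 zero_le_one)
    (show Continuous fun y => u y - κ * (1 - ‖y - z‖ ^ 2) by fun_prop).continuousOn
  have hneg : u x - κ * (1 - ‖x - z‖ ^ 2) < 0 :=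
    (hxmin (ball_subset_closedBall hy)).trans_lt (sub_neg.2 huy)
  have hglobal : ∀ y, u x - κ * (1 - ‖x - z‖ ^ 2) ≤ u y - κ * (1 - ‖y - z‖ ^ 2) := fun y => by
    by_cases hy : y ∈ closedBall z 1
    · exact hxmin hy
    · have hyz : 1 < ‖y - z‖ := by simpa [dist_eq_norm] using hy
      have : κ * (1 - ‖y - z‖ ^ 2) ≤ 0 :=
        mul_nonpos_of_nonneg_of_nonpos hκ (sub_nonpos.2 (one_le_pow₀ hyz.le))
      linarith [hu_nonneg y]
  have hxz : ‖x - z‖ < 1 := by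
    rw [← sq_lt_one_iff₀ (norm_nonneg _)]
    by_contra! h
    linarith [hu_nonneg x, mul_nonpos_of_nonneg_of_nonpos hκ (sub_nonpos.2 h)]
  refine ⟨x, mem_ball_iff_norm.2 hxz, (2 * κ) • (x - z), ?_, ?_, fun ζ => ?_⟩
  · rw [norm_smul, Real.norm_of_nonneg (by positivity)]
    exact mul_le_of_le_one_right (by positivity) hxz.le
  · linarith [mul_nonneg hκ (sq_nonneg ‖x - z‖)]
  · have hsq : ‖x + ζ - z‖ ^ 2 = ‖x - z‖ ^ 2 + 2 * ⟪x - z, ζ⟫ + ‖ζ‖ ^ 2 := by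
      rw [add_sub_right_comm, norm_add_sq_real]
    have hmin := hglobal (x + ζ)
    rw [hsq] at hmin
    rw [real_inner_smul_left]
    linarith

variable [MeasurableSpace E] [BorelSpace E] {G : ℝ → ℝ} {p c₀ r b : ℝ}

lemma HasPV.tailIntegral_le (hp : finrank ℝ E < p) (hc₀ : 0 ≤ c₀)
    (hG : Monotone fun t => G t - c₀ * t) (hu : Continuous u) (hu_nonneg : ∀ y, 0 ≤ u y)
    (h : HasPV G p u x b) (hr : 0 < r) {S : Set E} (hS : MeasurableSet S) {L : ℝ}
    (hSr : ∀ y ∈ S, r ≤ ‖x - y‖) (hSL : ∀ y ∈ S, ‖x - y‖ ≤ L) :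
    tailIntegral G p u x r ≤
      G (u x) * (∫ z in (ball (0 : E) r)ᶜ, ‖z‖ ^ (-p)) - c₀ * L ^ (-p) * ∫ y in S, u y := by
  have hball : S ⊆ (ball x r)ᶜ := fun y hy => by simpa [dist_eq_norm'] using hSr y hy
  have hker := integrableOn_norm_sub_rpow_compl_ball hp x hr
  have huS : IntegrableOn u S := (hu.continuousOn.integrableOn_compact
    (isCompact_closedBall x L)).mono_set fun y hy => by simpa [dist_eq_norm'] using hSL y hy
  have huS' : Integrable (S.indicator fun y => c₀ * L ^ (-p) * u y) :=
    (integrable_indicator_iff hS).2 (huS.const_mul _)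
  have htranslate : ∫ y in (ball x r)ᶜ, ‖x - y‖ ^ (-p) = ∫ z in (ball (0 : E) r)ᶜ, ‖z‖ ^ (-p) := by
    have hpre : (fun z => x + z) ⁻¹' (ball x r)ᶜ = (ball 0 r)ᶜ := by simp
    rw [← (measurePreserving_add_left volume x).setIntegral_preimage_emb
      (measurableEmbedding_addLeft x), hpre]
    simp only [sub_add_cancel_left, norm_neg]
  have hpoint : ∀ y, G (u x - u y) * ‖x - y‖ ^ (-p) ≤
      G (u x) * ‖x - y‖ ^ (-p) - S.indicator (fun y => c₀ * L ^ (-p) * u y) y := fun y => by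
    have hslope := mul_sub_le_sub_of_monotone hG (sub_le_self (u x) (hu_nonneg y))
    have hle : S.indicator (fun y => c₀ * L ^ (-p) * u y) y ≤ c₀ * u y * ‖x - y‖ ^ (-p) := by
      refine Set.indicator_apply_le' (fun hy => ?_) fun _ => by have := hu_nonneg y; positivity
      rw [mul_right_comm]
      refine mul_le_mul_of_nonneg_left ?_ (mul_nonneg hc₀ (hu_nonneg y))
      exact Real.rpow_le_rpow_of_nonpos (hr.trans_le (hSr y hy)) (hSL y hy)
        (neg_nonpos.2 ((Nat.cast_nonneg _).trans hp.le))
    have hmul := mul_le_mul_of_nonneg_right hslope (show 0 ≤ ‖x - y‖ ^ (-p) by positivity)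
    linarith
  calc tailIntegral G p u x r
      ≤ ∫ y in (ball x r)ᶜ, (G (u x) * ‖x - y‖ ^ (-p) -
          S.indicator (fun y => c₀ * L ^ (-p) * u y) y) :=
        integral_mono (h.integrableOn r hr) ((hker.const_mul _).sub huS'.integrableOn) hpoint
    _ = _ := by
        rw [integral_sub (hker.const_mul _) huS'.integrableOn, integral_const_mul, htranslate,
          setIntegral_indicator hS, Set.inter_eq_right.2 hball, integral_const_mul]

lemma HasPV.le_add_tailIntegral [Nontrivial E] (hp : p < finrank ℝ E + 2) (hG : Continuous G)
    (hGm : Monotone G) (hu : Continuous u) (h : HasPV G p u x b) {C : NNReal} {κ M A : ℝ} {v : E}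
    (hC : LipschitzOnWith C G (Set.Icc (-M) M)) (hκ : 0 ≤ κ) (hκM : ‖v‖ + κ ≤ M)
    (hv : ∀ ζ, u x - u (x + ζ) ≤ ⟪v, ζ⟫ + κ * ‖ζ‖ ^ 2) (hr : 0 < r) (hr1 : r ≤ 1)
    (hA : ∀ ε, 0 < ε → ε ≤ r → annulusIntegral G p ε r (fun ζ => ⟪v, ζ⟫) ≤ A) :
    b ≤ A + C * κ * (∫ ζ in ball (0 : E) 1, ‖ζ‖ ^ 2 * ‖ζ‖ ^ (-p)) + tailIntegral G p u x r := by
  refine le_of_tendsto h.tendsto ?_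
  filter_upwards [Ioc_mem_nhdsGT hr] with ε hε
  have hvM : ∀ ζ ∈ ball (0 : E) 1, |⟪v, ζ⟫| + κ ≤ M := fun ζ hζ => by
    have := mul_le_of_le_one_right (norm_nonneg v) (mem_ball_zero_iff.1 hζ).le
    linarith [abs_real_inner_le_norm v ζ]
  rw [h.tailIntegral_eq_add hε.1 hε.2]
  gcongr
  exact (annulusIntegral_le_add hp hG hGm hC (by fun_prop) (by fun_prop) hκ (fun ζ _ => hv ζ) hvM
    hε.1 hr1).trans (by gcongr; exact hA ε hε.1 hε.2)

lemma exists_setIntegral_le_mul_of_touching [Nontrivial E] (hp : finrank ℝ E < p)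
    (hp₂ : p < finrank ℝ E + 2) (hc₀ : 0 < c₀) (hG : Monotone fun t => G t - c₀ * t)
    (hGlip : LocallyLipschitz G) (hG₀ : G 0 = 0) (hgrad : HasGradientBound E G p)
    (hu : Continuous u) (hu_nonneg : ∀ y, 0 ≤ u y) {Ω : Set E} {K : ℝ} (hK : 0 ≤ K)
    (hΩ : ∀ x ∈ Ω, ∃ b, HasPV G p u x b ∧ -(K * u x) ≤ b) {κ₀ L : ℝ} (hκ₀ : 0 < κ₀) (hL : 0 < L) :
    ∃ C, ∀ κ, 0 ≤ κ → κ ≤ κ₀ → ∀ z, ball z 1 ⊆ Ω →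
      (∃ y ∈ ball z 1, u y < κ * (1 - ‖y - z‖ ^ 2)) →
      ∀ S, MeasurableSet S → S ⊆ ball z L \ ball z 2 → ∫ y in S, u y ≤ C * κ := by
  obtain ⟨r, hr, hr1, A, hA, hgradA⟩ := hgrad (2 * κ₀) (by positivity)
  obtain ⟨Λ, hΛ⟩ := exists_lipschitzOnWith_Icc hGlip (3 * κ₀)
  set I₂ := ∫ ζ in ball (0 : E) 1, ‖ζ‖ ^ 2 * ‖ζ‖ ^ (-p)
  set J := ∫ ζ in (ball (0 : E) r)ᶜ, ‖ζ‖ ^ (-p)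
  have : 0 ≤ J := integral_nonneg fun ζ => by positivity
  have hL' : 0 < c₀ * (1 + L) ^ (-p) := by positivity
  refine ⟨(K + A * 2 + Λ * I₂ + Λ * J) / (c₀ * (1 + L) ^ (-p)),
    fun κ hκ hκκ₀ z hz ⟨y, hy, huy⟩ S hS hSz => ?_⟩
  obtain ⟨x, hx, v, hv, hux, htouch⟩ := exists_sub_le_inner_add_sq hu hu_nonneg hκ hy huy
  obtain ⟨b, hb, hKb⟩ := hΩ x (hz hx)
  have hGux : G (u x) ≤ Λ * κ := by
    have hlip := hΛ.dist_le_mul (u x) ⟨by linarith [hu_nonneg x], by linarith⟩ 0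
      ⟨by linarith, by linarith⟩
    rw [hG₀, dist_zero_right, dist_zero_right, Real.norm_of_nonneg (hu_nonneg x)] at hlip
    exact (Real.le_norm_self _).trans (hlip.trans (by gcongr))
  have hb_le := hb.le_add_tailIntegral hp₂ hGlip.continuous
    (monotone_of_monotone_sub_mul hc₀.le hG) hu hΛ hκ (by linarith) htouch hr hr1 (A := A * (2 * κ))
    fun ε hε hεr => (hgradA v (hv.trans (by gcongr)) ε hε hεr).trans (by gcongr)
  have hx1 : ‖x - z‖ < 1 := mem_ball_iff_norm.1 hx
  have htail := hb.tailIntegral_le hp hc₀.le hG hu hu_nonneg hr hS (L := 1 + L)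
    (fun y hy => by
      have hyz : 2 ≤ ‖z - y‖ := by simpa [dist_eq_norm'] using (hSz hy).2
      linarith [norm_sub_le_norm_sub_add_norm_sub z x y, norm_sub_rev x z])
    (fun y hy => by
      have hyz : ‖z - y‖ < L := by simpa [dist_eq_norm'] using (hSz hy).1
      linarith [norm_sub_le_norm_sub_add_norm_sub x z y])
  rw [div_mul_eq_mul_div, le_div_iff₀ hL']
  have : G (u x) * J ≤ Λ * κ * J := by gcongr
  have : K * u x ≤ K * κ := by gcongr
  linarith

end WeakHarnack

section Tent

variable {E : Type*} [NormedAddCommGroup E] {q y w : E} {ρ : ℝ}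

/-- The piecewise linear bump of height one and radius `ρ` centred at `q`. -/
noncomputable def tent (q : E) (ρ : ℝ) (y : E) : ℝ :=
  max 0 (1 - ‖y - q‖ / ρ)

lemma tent_nonneg : 0 ≤ tent q ρ y := le_max_left _ _

lemma tent_le_one (hρ : 0 ≤ ρ) : tent q ρ y ≤ 1 :=
  max_le zero_le_one (sub_le_self _ (by positivity))

lemma tent_eq_zero (hρ : 0 < ρ) (hy : y ∉ ball q ρ) : tent q ρ y = 0 := by
  rw [mem_ball_iff_norm, not_lt] at hy
  exact max_eq_left (sub_nonpos.2 ((one_le_div hρ).2 hy))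

lemma one_half_le_tent (hρ : 0 < ρ) (hy : y ∈ ball q (ρ / 2)) : 1 / 2 ≤ tent q ρ y := by
  rw [mem_ball_iff_norm] at hy
  have : ‖y - q‖ / ρ ≤ 1 / 2 := by
    rw [div_le_iff₀ hρ]
    linarith
  exact le_max_of_le_right (by linarith)

@[fun_prop]
lemma continuous_tent : Continuous (tent q ρ) := by
  unfold tent
  fun_prop

lemma tent_sub_tent_add_le (hρ : 0 ≤ ρ) : tent q ρ y - tent q ρ (y + w) ≤ ‖w‖ / ρ := by
  have htri : ‖y + w - q‖ / ρ ≤ ‖y - q‖ / ρ + ‖w‖ / ρ := by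
    rw [← add_div, add_sub_right_comm]
    gcongr
    exact norm_add_le _ _
  have hw : 0 ≤ ‖w‖ / ρ := by positivity
  rw [sub_le_iff_le_add']
  refine max_le (add_nonneg tent_nonneg hw) ?_
  linarith [le_max_right 0 (1 - ‖y + w - q‖ / ρ), show tent q ρ (y + w) = max 0 _ from rfl]

lemma hasCompactSupport_tent [ProperSpace E] (hρ : 0 < ρ) : HasCompactSupport (tent q ρ) :=
  .intro (isCompact_closedBall q ρ) fun _ hy =>
    tent_eq_zero hρ fun h => hy (ball_subset_closedBall h)

end Tent

section Drop

variable {E : Type*} [NormedAddCommGroup E] [NormedSpace ℝ E] [FiniteDimensional ℝ E]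
  [MeasureSpace E] [BorelSpace E] [(volume : Measure E).IsAddHaarMeasure] {u g : E → ℝ} {q : E}
  {ρ d : ℝ}

lemma integrable_mul_tent (hu : Continuous u) (hρ : 0 < ρ) :
    Integrable fun y => u y * tent q ρ y :=
  (hu.mul continuous_tent).integrable_of_hasCompactSupport (hasCompactSupport_tent hρ).mul_left

lemma le_integral_tent (hρ : 0 < ρ) :
    volume.real (ball q (ρ / 2)) * (1 / 2) ≤ ∫ y, tent q ρ y := by
  have htent : Integrable (tent q ρ) :=
    continuous_tent.integrable_of_hasCompactSupport (hasCompactSupport_tent hρ)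
  calc volume.real (ball q (ρ / 2)) * (1 / 2) = ∫ y in ball q (ρ / 2), (1 / 2 : ℝ) := by
        rw [setIntegral_const, smul_eq_mul]
    _ ≤ ∫ y in ball q (ρ / 2), tent q ρ y :=
        setIntegral_mono_on (integrableOn_const measure_ball_lt_top.ne) htent.integrableOn
          measurableSet_ball fun y hy => one_half_le_tent hρ hy
    _ ≤ ∫ y, tent q ρ y := setIntegral_le_integral htent (.of_forall fun _ => tent_nonneg)

-- The translation is moved onto the Lipschitz function `tent`, as `u` itself has no modulus.
lemma integral_sub_translate_mul_tent_le (hu : Continuous u) (hu_nonneg : ∀ y, 0 ≤ u y)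
    (hρ : 0 < ρ) (w : E) :
    ∫ y, (u y - u (y - w)) * tent q ρ y ≤ ‖w‖ / ρ * ∫ y in ball q ρ, u y := by
  have hint := integrable_mul_tent (q := q) hu hρ
  have hint' : Integrable fun y => u (y - w) * tent q ρ y := integrable_mul_tent (by fun_prop) hρ
  have hshift : ∫ y, u (y - w) * tent q ρ y = ∫ y, u y * tent q ρ (y + w) := by
    simpa using (integral_add_right_eq_self (fun y => u (y - w) * tent q ρ y) w).symm
  have hint'' : Integrable fun y => u y * tent q ρ (y + w) := by simpa using hint'.comp_add_right w
  have huB : IntegrableOn u (ball q ρ) := integrableOn_ball_of_continuous hu q ρ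
  simp only [sub_mul]
  rw [integral_sub hint hint', hshift, ← integral_sub hint hint'', ← integral_const_mul,
    ← integral_indicator measurableSet_ball]
  refine integral_mono (hint.sub hint'')
    ((integrable_indicator_iff measurableSet_ball).2 (huB.const_mul _)) fun y => ?_
  simp only [← mul_sub]
  by_cases hy : y ∈ ball q ρ
  · rw [Set.indicator_of_mem hy, mul_comm]
    exact mul_le_mul_of_nonneg_right (tent_sub_tent_add_le hρ.le) (hu_nonneg y)
  · rw [Set.indicator_of_notMem hy, tent_eq_zero hρ hy, zero_sub]
    exact mul_nonpos_of_nonneg_of_nonpos (hu_nonneg y) (neg_nonpos.2 tent_nonneg)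

lemma sub_le_setIntegral_ball (hu : Continuous u) (hu_nonneg : ∀ y, 0 ≤ u y) (hρ : 0 < ρ)
    (hd : 0 ≤ d) (w : E) (hg : IntegrableOn g (ball q ρ)) (hg_nonneg : ∀ y ∈ ball q ρ, 0 ≤ g y)
    (hgd : ∀ y ∈ ball q ρ, d - (u y - u (y - w)) ≤ g y) :
    d * (volume.real (ball q (ρ / 2)) * (1 / 2)) - ‖w‖ / ρ * ∫ y in ball q ρ, u y ≤
      ∫ y in ball q ρ, g y := by
  have hconst : Integrable fun y => d * tent q ρ y := integrable_mul_tent (by fun_prop) hρ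
  have hdrop : Integrable fun y => (u y - u (y - w)) * tent q ρ y :=
    integrable_mul_tent (by fun_prop) hρ
  calc d * (volume.real (ball q (ρ / 2)) * (1 / 2)) - ‖w‖ / ρ * ∫ y in ball q ρ, u y
      ≤ d * (∫ y, tent q ρ y) - ∫ y, (u y - u (y - w)) * tent q ρ y := by
        gcongr
        · exact le_integral_tent hρ
        · exact integral_sub_translate_mul_tent_le hu hu_nonneg hρ w
    _ = ∫ y, (d * tent q ρ y - (u y - u (y - w)) * tent q ρ y) := by
        rw [integral_sub hconst hdrop, integral_const_mul]
    _ ≤ ∫ y, (ball q ρ).indicator g y := by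
        refine integral_mono (hconst.sub hdrop)
          ((integrable_indicator_iff measurableSet_ball).2 hg) fun y => ?_
        simp only [← sub_mul]
        by_cases hy : y ∈ ball q ρ
        · rw [Set.indicator_of_mem hy]
          exact (mul_le_mul_of_nonneg_right (hgd y hy) tent_nonneg).trans
            (mul_le_of_le_one_right (hg_nonneg y hy) (tent_le_one hρ.le))
        · rw [Set.indicator_of_notMem hy, tent_eq_zero hρ hy, mul_zero]
    _ = ∫ y in ball q ρ, g y := integral_indicator measurableSet_ball

end Drop

section NegativeMinimum

variable {E : Type*} [NormedAddCommGroup E] [InnerProductSpace ℝ E] {e z : E} {l κ : ℝ}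
  {u : E → ℝ}

/-- On the half space below the level `l`, the function `u` lies below its mirror image: the
property propagated in the method of moving planes. -/
def ReflectionMonotone (e : E) (l : ℝ) (u : E → ℝ) : Prop :=
  ∀ y ∈ below e l, u y ≤ u (mirror e l y)

lemma exists_isNegReflectionMin (he : ‖e‖ = 1) (hu : Continuous u)
    (hu₀ : Tendsto u (cocompact E) (𝓝 0)) (hmono : ¬ ReflectionMonotone e l u) :
    ∃ x, IsNegReflectionMin e l u x := by
  obtain ⟨y, hy, hneg⟩ : ∃ y ∈ below e l, u (mirror e l y) - u y < 0 := by
    simpa only [ReflectionMonotone, not_forall, not_le, exists_prop, sub_neg] using hmono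
  have hlim : Tendsto (fun y => u (mirror e l y) - u y) (cocompact E) (𝓝 0) := by
    simpa using (hu₀.comp (mirror e l).toHomeomorph.isClosedEmbedding.tendsto_cocompact).sub hu₀
  obtain ⟨x, hxl, hxmin⟩ := ((hu.comp (mirror e l).continuous).sub hu).continuousOn.exists_isMinOn'
    (isClosed_le (by fun_prop) continuous_const : IsClosed {y | ⟪e, y⟫ ≤ l}) (mem_below.1 hy).le
    (((hlim.eventually_const_lt hneg).mono fun _ => le_of_lt).filter_mono inf_le_left)
  have hx : u (mirror e l x) - u x < 0 := (hxmin (mem_below.1 hy).le).trans_lt hneg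
  refine ⟨x, lt_of_le_of_ne hxl fun h => ?_, sub_neg.1 hx, fun y hy => hxmin (mem_below.1 hy).le⟩
  simp [mirror_apply he, h] at hx

variable [FiniteDimensional ℝ E] [MeasurableSpace E] [BorelSpace E]

lemma setIntegral_ball_comp_mirror (q : E) (r : ℝ) :
    ∫ y in ball q r, u (mirror e l y) = ∫ y in ball (mirror e l q) r, u y := by
  rw [← measurePreserving_mirror.setIntegral_preimage_emb measurableEmbedding_mirror u,
    (mirror e l).preimage_ball, (mirror e l).symm_apply_apply]

lemma exists_lt_mul_one_sub_sq (hu : Continuous u) (hu_nonneg : ∀ y, 0 ≤ u y) (hκ : 0 ≤ κ)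
    (hint : ∫ y in ball z 1, u y < κ * (volume.real (ball z (1 / 2)) * (1 / 2))) :
    ∃ y ∈ ball z 1, u y < κ * (1 - ‖y - z‖ ^ 2) := by
  have hu1 : IntegrableOn u (ball z 1) := integrableOn_ball_of_continuous hu z 1
  have hsub : ball z (1 / 2) ⊆ ball z 1 := ball_subset_ball (by norm_num)
  contrapose! hint
  calc κ * (volume.real (ball z (1 / 2)) * (1 / 2))
      = ∫ y in ball z (1 / 2), κ * (1 / 2) := by
        rw [setIntegral_const, smul_eq_mul]
        ring
    _ ≤ ∫ y in ball z (1 / 2), u y := by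
        refine setIntegral_mono_on (integrableOn_const measure_ball_lt_top.ne)
          (hu1.mono_set hsub) measurableSet_ball fun y hy => le_trans ?_ (hint y (hsub hy))
        have : ‖y - z‖ ^ 2 ≤ (1 / 2) ^ 2 :=
          pow_le_pow_left₀ (norm_nonneg _) (mem_ball_iff_norm.1 hy).le 2
        gcongr
        linarith
    _ ≤ ∫ y in ball z 1, u y :=
        setIntegral_mono_set hu1 (Eventually.of_forall hu_nonneg) hsub.eventuallyLE

end NegativeMinimum

/-- `u` is a nonnegative continuous solution, vanishing at infinity and outside the half space
`{x | 0 < ⟪e, x⟫}`, of the equation `PV ∫ G (u x - u z) * ‖x - z‖ ^ (-p) dz = h (u x)` in that half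
space. -/
structure IsHalfSpaceSolution {E : Type*} [NormedAddCommGroup E] [InnerProductSpace ℝ E]
    [FiniteDimensional ℝ E] [MeasurableSpace E] [BorelSpace E] (G : ℝ → ℝ) (p : ℝ) (e : E)
    (h : ℝ → ℝ) (u : E → ℝ) : Prop where
  continuous : Continuous u
  nonneg : ∀ x, 0 ≤ u x
  eq_zero : ∀ x, ⟪e, x⟫ ≤ 0 → u x = 0
  tendsto_zero : Tendsto u (cocompact E) (𝓝 0)
  hasPV : ∀ x, 0 < ⟪e, x⟫ → HasPV G p u x (h (u x))

namespace IsHalfSpaceSolution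

variable {E : Type*} [NormedAddCommGroup E] [InnerProductSpace ℝ E] [FiniteDimensional ℝ E]
  [MeasurableSpace E] [BorelSpace E] {e x : E} {l p c₀ : ℝ} {G h : ℝ → ℝ} {u : E → ℝ} {K : NNReal}

lemma inner_pos (hu : IsHalfSpaceSolution G p e h u) (hx : 0 < u x) : 0 < ⟪e, x⟫ := by
  by_contra! hle
  exact hx.ne' (hu.eq_zero x hle)

lemma exists_forall_le (hu : IsHalfSpaceSolution G p e h u) : ∃ M, ∀ x, u x ≤ M := by
  have := ZeroAtInftyContinuousMap.isBounded_range (⟨⟨u, hu.continuous⟩, hu.tendsto_zero⟩ :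
    ZeroAtInftyContinuousMap E ℝ)
  obtain ⟨M, hM⟩ := this.bddAbove
  exact ⟨M, fun x => hM ⟨x, rfl⟩⟩

lemma inner_pos_of_isNegReflectionMin (hu : IsHalfSpaceSolution G p e h u)
    (hx : IsNegReflectionMin e l u x) : 0 < ⟪e, x⟫ :=
  hu.inner_pos ((hu.nonneg _).trans_lt hx.lt)

lemma hasPV_mirror (hu : IsHalfSpaceSolution G p e h u) (he : ‖e‖ = 1)
    (hx : IsNegReflectionMin e l u x) :
    HasPV G p u (mirror e l x) (h (u (mirror e l x))) :=
  hu.hasPV _ (by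
    rw [inner_mirror he]
    linarith [hu.inner_pos_of_isNegReflectionMin hx, hx.inner_lt])

end IsHalfSpaceSolution

lemma exists_pos_forall_lt_mul_rpow_neg_mul_pow {p A : ℝ} {n : ℕ} (hp : n < p) (hA : 0 < A)
    (K : ℝ) : ∃ δ₀ > 0, ∀ δ, 0 < δ → δ ≤ δ₀ → K < A * (δ ^ (-p) * δ ^ n) := by
  have hlim : Tendsto (fun δ : ℝ => A * δ ^ (n - p)) (𝓝[>] 0) atTop :=
    (tendsto_rpow_neg_nhdsGT_zero (sub_neg.2 hp)).const_mul_atTop hA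
  obtain ⟨δ₀, hδ₀, hsub⟩ := mem_nhdsGT_iff_exists_Ioc_subset.1 (hlim.eventually_gt_atTop K)
  refine ⟨δ₀, hδ₀, fun δ hδ hδδ₀ => ?_⟩
  rw [← Real.rpow_add_natCast hδ.ne', neg_add_eq_sub]
  exact hsub ⟨hδ, hδδ₀⟩

lemma one_sub_two_rpow_neg_pos {p : ℝ} (hp : 0 < p) : 0 < 1 - (2 : ℝ) ^ (-p) :=
  sub_pos.2 (Real.rpow_lt_one_of_one_lt_of_neg one_lt_two (neg_lt_zero.2 hp))

lemma exists_radius_lt_mul_volume_ball {E : Type*} [NormedAddCommGroup E] [InnerProductSpace ℝ E]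
    [FiniteDimensional ℝ E] [MeasurableSpace E] [BorelSpace E] {p c δ : ℝ} (hp : finrank ℝ E < p)
    (hc : 0 < c) (hδ : 0 < δ) (K : ℝ) :
    ∃ ρ > 0, 2 * ρ ≤ δ ∧
      K < c * (ρ ^ (-p) * (1 - 2 ^ (-p))) * (volume.real (ball (0 : E) (ρ / 2)) * (1 / 2)) := by
  have hV := volume_real_ball_pos (0 : E) one_pos
  have := one_sub_two_rpow_neg_pos ((Nat.cast_nonneg _).trans_lt hp)
  obtain ⟨ρ₀, hρ₀, hsmall⟩ := exists_pos_forall_lt_mul_rpow_neg_mul_pow hp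
    (show 0 < c * (1 - 2 ^ (-p)) * (1 / 2) ^ finrank ℝ E * volume.real (ball (0 : E) 1) * (1 / 2)
      by positivity) K
  have hρ : 0 < min ρ₀ (δ / 2) := by positivity
  refine ⟨min ρ₀ (δ / 2), hρ, by linarith [min_le_right ρ₀ (δ / 2)], ?_⟩
  refine (hsmall _ hρ (min_le_left _ _)).trans_eq ?_
  rw [volume_real_ball 0 (half_pos hρ), div_eq_mul_one_div (min ρ₀ (δ / 2)), mul_pow]
  ring

lemma IsNegReflectionMin.sub_le_mul {E : Type*} [NormedAddCommGroup E] [InnerProductSpace ℝ E]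
    {e x : E} {l : ℝ} {h : ℝ → ℝ} {u : E → ℝ} {K : NNReal}
    (hh : LipschitzOnWith K h (Set.range u)) (hx : IsNegReflectionMin e l u x) :
    h (u x) - h (u (mirror e l x)) ≤ K * (u x - u (mirror e l x)) := by
  have hlip := hh.dist_le_mul (u x) ⟨x, rfl⟩ (u (mirror e l x)) ⟨_, rfl⟩
  rw [Real.dist_eq, Real.dist_eq, abs_of_pos (sub_pos.2 hx.lt)] at hlip
  exact (le_abs_self _).trans hlip

namespace IsHalfSpaceSolution

variable {E : Type*} [NormedAddCommGroup E] [InnerProductSpace ℝ E] [FiniteDimensional ℝ E]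
  [MeasurableSpace E] [BorelSpace E] {e x : E} {l p c₀ : ℝ} {G h : ℝ → ℝ} {u : E → ℝ} {K : NNReal}

lemma neg_mul_le (hu : IsHalfSpaceSolution G p e h u) (hh : LipschitzOnWith K h (Set.range u))
    (hh₀ : h 0 = 0) (x : E) : -(K * u x) ≤ h (u x) := by
  have hu0 : u 0 = 0 := hu.eq_zero 0 (inner_zero_right e).le
  have hlip := hh.dist_le_mul (u x) ⟨x, rfl⟩ (u 0) ⟨0, rfl⟩
  rw [hu0, hh₀, dist_zero_right, dist_zero_right, Real.norm_of_nonneg (hu.nonneg x)] at hlip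
  exact (abs_le.1 hlip).1

variable (he : ‖e‖ = 1) (hc₀ : 0 < c₀) (hG : Monotone fun t => G t - c₀ * t)
  (hh : LipschitzOnWith K h (Set.range u)) (hu : IsHalfSpaceSolution G p e h u)

include he hc₀ hG hh hu

lemma exists_pos_le_sub_inner (hp : finrank ℝ E < p) :
    ∃ δ > 0, ∀ l x, IsNegReflectionMin e l u x → δ ≤ l - ⟪e, x⟫ := by
  have hV := volume_real_ball_pos (0 : E) one_pos
  have hp₀ : 0 ≤ p := (Nat.cast_nonneg _).trans hp.le
  obtain ⟨δ, hδ, hsmall⟩ := exists_pos_forall_lt_mul_rpow_neg_mul_pow hp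
    (show 0 < 2 * c₀ * 3 ^ (-p) * volume.real (ball (0 : E) 1) by positivity) K
  refine ⟨δ, hδ, fun l x hx => ?_⟩
  by_contra! hlt
  have hs : 0 < l - ⟪e, x⟫ := sub_pos.2 hx.inner_lt
  have hbound := ((hu.hasPV x (hu.inner_pos_of_isNegReflectionMin hx)).mul_rpow_mul_volume_le_sub
    he hp₀ hc₀.le hG hx (hu.hasPV_mirror he hx)).trans (hx.sub_le_mul hh)
  rw [volume_real_ball x hs, Real.mul_rpow zero_le_three hs.le] at hbound
  linarith [mul_lt_mul_of_pos_right (hsmall _ hs hlt.le) (sub_pos.2 hx.lt)]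

lemma mul_setIntegral_ball_mirror_le (hp : 0 ≤ p) (hx : IsNegReflectionMin e l u x) {q : E}
    {r k₀ : ℝ} (hk₀ : 0 ≤ k₀) (hq : ∀ y ∈ ball q r, ⟪e, y⟫ ≤ 0)
    (hgap : ∀ y ∈ ball q r, y ≠ x → k₀ ≤ ‖x - y‖ ^ (-p) - ‖x - mirror e l y‖ ^ (-p)) :
    c₀ * k₀ * ∫ y in ball (mirror e l q) r, u y ≤ K * (u x - u (mirror e l x)) := by
  have hx₀ := hu.inner_pos_of_isNegReflectionMin hx
  have hbelow : ball q r ⊆ below e l := fun y hy => (hq y hy).trans_lt (hx₀.trans hx.inner_lt)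
  have hcont : Continuous fun y => u (mirror e l y) := hu.continuous.comp (mirror e l).continuous
  refine le_trans ?_ (((hu.hasPV x hx₀).mul_setIntegral_ball_le_sub he hp hc₀.le hG hx
    (hu.hasPV_mirror he hx) hu.continuous hbelow hgap).trans (hx.sub_le_mul hh))
  rw [← setIntegral_ball_comp_mirror]
  gcongr ?_ * ?_
  refine setIntegral_mono_on (integrableOn_ball_of_continuous hcont q r)
    (integrableOn_ball_of_continuous ((hcont.sub hu.continuous).add_const _) q r)
    measurableSet_ball fun y hy => ?_
  rw [hu.eq_zero y (hq y hy)]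
  linarith [hx.lt]

-- This ball is the mirror image of a ball on the other side of the boundary, where `u` vanishes.
lemma exists_setIntegral_far_ball_le (hp : finrank ℝ E < p) {Λ : ℝ} (hΛ : 0 ≤ Λ) :
    ∃ C, 0 ≤ C ∧ ∀ l ≤ Λ, ∀ x, IsNegReflectionMin e l u x →
      ∫ y in ball (x + (2 * l + 2 - ⟪e, x⟫) • e) 1, u y ≤ C * (u x - u (mirror e l x)) := by
  have hp₀ : 0 < p := (Nat.cast_nonneg _).trans_lt hp
  obtain ⟨δ, hδ, hdist⟩ := hu.exists_pos_le_sub_inner he hc₀ hG hh hp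
  obtain ⟨k₀, hk₀, hgap⟩ := exists_pos_le_norm_rpow_gap he hp₀ hδ (by linarith : 0 < Λ + 3)
  refine ⟨K / (c₀ * k₀), by positivity, fun l hl x hx => ?_⟩
  have hx₀ := hu.inner_pos_of_isNegReflectionMin hx
  have hxl := hx.inner_lt
  set q := x - (⟪e, x⟫ + 2) • e with hq
  have hqe : ⟪e, q⟫ = -2 := by
    rw [inner_sub_smul he]
    ring
  have hqx : ‖x - q‖ = ⟪e, x⟫ + 2 := by
    rw [hq, sub_sub_cancel, norm_smul, he, mul_one, Real.norm_of_nonneg (by linarith)]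
  have hqR : mirror e l q = x + (2 * l + 2 - ⟪e, x⟫) • e := by
    rw [mirror_apply he, hqe, hq]
    module
  have hball : ball q 1 ⊆ below e (-1) := ball_subset_below he (by linarith)
  rw [← hqR, div_mul_eq_mul_div, le_div_iff₀ (by positivity), mul_comm]
  refine hu.mul_setIntegral_ball_mirror_le he hc₀ hG hh hp₀.le hx hk₀.le
    (fun y hy => by linarith [mem_below.1 (hball hy)]) fun y hy hyx =>
      hgap l x y (hdist l x hx) (by linarith [mem_below.1 (hball hy)]) ?_ hyx
  linarith [norm_sub_le_norm_sub_add_norm_sub x q y, mem_ball_iff_norm'.1 hy]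

lemma exists_setIntegral_ball_le [Nontrivial E] (hp : finrank ℝ E < p)
    (hp₂ : p < finrank ℝ E + 2) (hGlip : LocallyLipschitz G) (hG₀ : G 0 = 0)
    (hgrad : HasGradientBound E G p) (hh₀ : h 0 = 0) {Λ : ℝ} (hΛ : 0 ≤ Λ) :
    ∃ C, ∀ l ≤ Λ, ∀ x, IsNegReflectionMin e l u x → ∀ ρ, ρ ≤ l - ⟪e, x⟫ →
      ∫ y in ball x ρ, u y ≤ C * (u x - u (mirror e l x)) := by
  obtain ⟨C₁, hC₁, hfar⟩ := hu.exists_setIntegral_far_ball_le he hc₀ hG hh hp hΛ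
  obtain ⟨M, hM⟩ := hu.exists_forall_le
  have hM₀ : 0 ≤ M := (hu.nonneg 0).trans (hM 0)
  set V := volume.real (ball (0 : E) (1 / 2)) * (1 / 2) with hV
  have hV₀ : 0 < V := mul_pos (volume_real_ball_pos 0 one_half_pos) one_half_pos
  set κ := (C₁ + 1) / V
  obtain ⟨C, htouch⟩ := exists_setIntegral_le_mul_of_touching hp hp₂ hc₀ hG hGlip hG₀ hgrad
    hu.continuous hu.nonneg K.2 (Ω := {x | 0 < ⟪e, x⟫})
    (fun x hx => ⟨_, hu.hasPV x hx, hu.neg_mul_le hh hh₀ x⟩)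
    (show 0 < κ * (M + 1) by positivity) (show 0 < 3 * Λ + 3 by positivity)
  refine ⟨C * κ, fun l hl x hx ρ hρ => ?_⟩
  have hx₀ := hu.inner_pos_of_isNegReflectionMin hx
  have hxl := hx.inner_lt
  set d := u x - u (mirror e l x)
  have hd : 0 < d := sub_pos.2 hx.lt
  have hdM : d ≤ M + 1 := by linarith [hM x, hu.nonneg (mirror e l x)]
  set z := x + (2 * l + 2 - ⟪e, x⟫) • e
  have hz : ball z 1 ⊆ {y | 0 < ⟪e, y⟫} := fun y hy => by
    have hze : ⟪e, z⟫ = ⟪e, x⟫ + (2 * l + 2 - ⟪e, x⟫) := inner_add_smul he x _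
    have hyz := (abs_le.1 (abs_inner_sub_inner_le he y z)).1
    have := mem_ball_iff_norm.1 hy
    exact (by linarith : 0 < ⟪e, y⟫)
  have hxz : dist x z = 2 * l + 2 - ⟪e, x⟫ := by
    rw [dist_self_add_right, norm_smul, he, mul_one, Real.norm_of_nonneg (by linarith)]
  have hsmall : ∃ y ∈ ball z 1, u y < κ * d * (1 - ‖y - z‖ ^ 2) := by
    refine exists_lt_mul_one_sub_sq hu.continuous hu.nonneg (by positivity) ?_
    rw [Measure.addHaar_real_ball_center, ← hV, mul_right_comm, div_mul_cancel₀ _ hV₀.ne']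
    linarith [hfar l hl x hx]
  rw [mul_assoc]
  exact htouch (κ * d) (by positivity) (by gcongr) z hz hsmall _ measurableSet_ball
    (Set.subset_sdiff.2 ⟨ball_subset_ball' (by linarith), ball_disjoint_ball (by linarith)⟩)

lemma mul_sub_le_mul_of_reflectionMonotone (hp : 0 < p) {η ρ : ℝ} (hη : 0 ≤ η) (hρ : 0 < ρ)
    (hmono : ReflectionMonotone e l u) (hx : IsNegReflectionMin e (l + η) u x)
    (hρx : 2 * ρ ≤ l + η - ⟪e, x⟫) :
    c₀ * (ρ ^ (-p) * (1 - 2 ^ (-p))) *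
        ((u x - u (mirror e (l + η) x)) * (volume.real (ball x (ρ / 2)) * (1 / 2)) -
          2 * η / ρ * ∫ y in ball x ρ, u y) ≤
      K * (u x - u (mirror e (l + η) x)) := by
  have hx₀ := hu.inner_pos_of_isNegReflectionMin hx
  have hbelow : ball x ρ ⊆ below e (l + η) := ball_subset_below he (by linarith)
  have hw : ‖(2 * η) • e‖ = 2 * η := by
    rw [norm_smul, he, mul_one, Real.norm_of_nonneg (by linarith)]
  set g := fun y => (u (mirror e (l + η) y) - u y) + (u x - u (mirror e (l + η) x))
  have hcont : Continuous g :=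
    ((hu.continuous.comp (mirror e (l + η)).continuous).sub hu.continuous).add_const _
  have hnear : c₀ * (ρ ^ (-p) * (1 - 2 ^ (-p))) * ∫ y in ball x ρ, g y ≤
      K * (u x - u (mirror e (l + η) x)) :=
    ((hu.hasPV x hx₀).mul_setIntegral_ball_self_le_sub he hp.le hc₀.le hG hx
      (hu.hasPV_mirror he hx) hu.continuous hρ.le hρx).trans (hx.sub_le_mul hh)
  have hmin : ∀ y ∈ ball x ρ, 0 ≤ g y := fun y hy => by linarith [hx.le y (hbelow hy)]
  have hdrop : ∀ y ∈ ball x ρ,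
      u x - u (mirror e (l + η) x) - (u y - u (y - (2 * η) • e)) ≤ g y := fun y hy => by
    have hy' : y - (2 * η) • e ∈ below e l := by
      rw [mem_below, inner_sub_smul he]
      linarith [mem_below.1 (hbelow hy)]
    have := hmono _ hy'
    rw [mirror_sub_smul he] at this
    linarith
  have htent := sub_le_setIntegral_ball hu.continuous hu.nonneg hρ (sub_nonneg.2 hx.lt.le)
    ((2 * η) • e) (integrableOn_ball_of_continuous hcont x ρ) hmin hdrop
  rw [hw] at htent
  have := one_sub_two_rpow_neg_pos hp
  exact (mul_le_mul_of_nonneg_left htent (by positivity)).trans hnear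

lemma exists_reflectionMonotone_add [Nontrivial E] (hp : finrank ℝ E < p)
    (hp₂ : p < finrank ℝ E + 2) (hGlip : LocallyLipschitz G) (hG₀ : G 0 = 0)
    (hgrad : HasGradientBound E G p) (hh₀ : h 0 = 0) {Λ : ℝ} (hΛ : 0 ≤ Λ) :
    ∃ η > 0, ∀ l, l + η ≤ Λ → ReflectionMonotone e l u → ReflectionMonotone e (l + η) u := by
  have hp₀ : 0 < p := (Nat.cast_nonneg _).trans_lt hp
  obtain ⟨δ, hδ, hdist⟩ := hu.exists_pos_le_sub_inner he hc₀ hG hh hp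
  obtain ⟨C, hmass⟩ := hu.exists_setIntegral_ball_le he hc₀ hG hh hp hp₂ hGlip hG₀ hgrad hh₀ hΛ
  obtain ⟨ρ, hρ, hρδ, hsmall⟩ := exists_radius_lt_mul_volume_ball (E := E) hp hc₀ hδ K
  set V := volume.real (ball (0 : E) (ρ / 2)) * (1 / 2) with hV
  set B := c₀ * (ρ ^ (-p) * (1 - 2 ^ (-p)))
  have := one_sub_two_rpow_neg_pos hp₀
  have : 0 < B := by positivity
  obtain ⟨η, hη, hηlt⟩ := exists_pos_mul_lt (sub_pos.2 hsmall) (B * (2 / ρ * C))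
  refine ⟨η, hη, fun l hlΛ hmono => ?_⟩
  by_contra hnot
  obtain ⟨x, hx⟩ := exists_isNegReflectionMin he hu.continuous hu.tendsto_zero hnot
  have hρx : 2 * ρ ≤ l + η - ⟪e, x⟫ := hρδ.trans (hdist _ _ hx)
  have hlower := hu.mul_sub_le_mul_of_reflectionMonotone he hc₀ hG hh hp₀ hη.le hρ hmono hx hρx
  have hupper := hmass _ hlΛ x hx ρ (by linarith)
  set d := u x - u (mirror e (l + η) x)
  have hd : 0 < d := sub_pos.2 hx.lt
  have hηd : B * (2 * η / ρ * ∫ y in ball x ρ, u y) ≤ B * (2 / ρ * C) * η * d :=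
    calc B * (2 * η / ρ * ∫ y in ball x ρ, u y) ≤ B * (2 * η / ρ * (C * d)) := by gcongr
      _ = _ := by ring
  rw [Measure.addHaar_real_ball_center, ← hV] at hlower
  linarith [mul_lt_mul_of_pos_right hηlt hd]

end IsHalfSpaceSolution

namespace IsHalfSpaceSolution

variable {E : Type*} [NormedAddCommGroup E] [InnerProductSpace ℝ E] [FiniteDimensional ℝ E]
  [MeasurableSpace E] [BorelSpace E] {e : E} {p c₀ : ℝ} {G h : ℝ → ℝ} {u : E → ℝ} {K : NNReal}

lemma reflectionMonotone_of_nonpos (hu : IsHalfSpaceSolution G p e h u) {l : ℝ} (hl : l ≤ 0) :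
    ReflectionMonotone e l u := fun y hy =>
  (hu.eq_zero y ((mem_below.1 hy).le.trans hl)).trans_le (hu.nonneg _)

lemma reflectionMonotone_of_step (hu : IsHalfSpaceSolution G p e h u) {Λ η : ℝ} (hη : 0 < η)
    (hstep : ∀ l, l + η ≤ Λ → ReflectionMonotone e l u → ReflectionMonotone e (l + η) u) :
    ReflectionMonotone e Λ u := by
  have hmono : ∀ k : ℕ, ∀ l ≤ Λ, l ≤ k * η → ReflectionMonotone e l u := fun k => by
    induction k with
    | zero => exact fun l _ hl => hu.reflectionMonotone_of_nonpos (by simpa using hl)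
    | succ k ih =>
      intro l hlΛ hl
      rw [Nat.cast_succ, add_one_mul] at hl
      simpa using hstep (l - η) (by linarith) (ih _ (by linarith) (by linarith))
  obtain ⟨k, hk⟩ := exists_nat_ge (Λ / η)
  exact hmono k Λ le_rfl ((div_le_iff₀ hη).1 hk)

lemma eq_zero_of_reflectionMonotone (hu : IsHalfSpaceSolution G p e h u) (he : ‖e‖ = 1)
    (hmono : ∀ l, 0 ≤ l → ReflectionMonotone e l u) (x : E) : u x = 0 := by
  refine le_antisymm (ge_of_tendsto (hu.tendsto_zero.comp (tendsto_mirror_cocompact he x)) ?_)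
    (hu.nonneg x)
  filter_upwards [eventually_ge_atTop 0, eventually_gt_atTop ⟪e, x⟫] with l hl hxl
  exact hmono l hl x hxl

theorem eq_zero_everywhere (hu : IsHalfSpaceSolution G p e h u) (he : ‖e‖ = 1)
    (hp : finrank ℝ E < p) (hp₂ : p < finrank ℝ E + 2) (hc₀ : 0 < c₀)
    (hG : Monotone fun t => G t - c₀ * t) (hGlip : LocallyLipschitz G) (hG₀ : G 0 = 0)
    (hh : LipschitzOnWith K h (Set.range u)) (hh₀ : h 0 = 0) (x : E) : u x = 0 := by
  have : Nontrivial E := ⟨e, 0, norm_ne_zero_iff.1 (he ▸ one_ne_zero)⟩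
  by_contra hx
  have hgrad : HasGradientBound E G p :=
    hasGradientBound hp₂ hGlip (monotone_of_monotone_sub_mul hc₀.le hG) hG₀ hu.continuous hu.nonneg
      hu.tendsto_zero (fun y hy => ⟨_, hu.hasPV y (hu.inner_pos hy)⟩) hx
  refine hx (hu.eq_zero_of_reflectionMonotone he (fun Λ hΛ => ?_) x)
  obtain ⟨η, hη, hstep⟩ :=
    hu.exists_reflectionMonotone_add he hc₀ hG hh hp hp₂ hGlip hG₀ hgrad hh₀ hΛ
  exact hu.reflectionMonotone_of_step hη hstep

end IsHalfSpaceSolution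

lemma monotone_sub_mul_of_le_deriv {G : ℝ → ℝ} {c₀ : ℝ} (hG : Differentiable ℝ G)
    (hG' : ∀ t, c₀ ≤ deriv G t) : Monotone fun t => G t - c₀ * t := by
  refine monotone_of_deriv_nonneg (by fun_prop) fun t => ?_
  rw [deriv_fun_sub (hG t) (by fun_prop), deriv_const_mul_field, deriv_id'', mul_one]
  exact sub_nonneg.2 (hG' t)

end HalfSpaceLiouville

theorem theorem3p3_general (m : ℕ) (α : ℝ) (hα0 : 0 < α) (hα2 : α < 2)
    (G : ℝ → ℝ) (hG : LocallyLipschitz G) (hG0 : G 0 = 0)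
    (c₀ : ℝ) (hc₀ : 0 < c₀) (hGm : Monotone fun t => G t - c₀ * t)
    (h : ℝ → ℝ) (u : EuclideanSpace ℝ (Fin (m + 1)) → ℝ)
    (hu_cont : Continuous u) (hu_nonneg : ∀ x, 0 ≤ u x)
    (hu_eq : ∀ x ∈ HalfSpaceLiouville.upperHalfSpace m,
      HalfSpaceLiouville.HasFAlpha G α u x (h (u x)))
    (hu_ext : ∀ x ∉ HalfSpaceLiouville.upperHalfSpace m, u x = 0)
    (hu_lim : Tendsto u (cocompact (EuclideanSpace ℝ (Fin (m + 1)))) (𝓝 0))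
    (hh_lip : ∃ K : NNReal, LipschitzOnWith K h (Set.range u)) (hh0 : h 0 = 0) :
    ∀ x, u x = 0 := by
  obtain ⟨K, hK⟩ := hh_lip
  set C := HalfSpaceLiouville.normConst (m + 1) α
  set e : EuclideanSpace ℝ (Fin (m + 1)) := EuclideanSpace.single (Fin.last m) 1
  have he : ∀ x, inner ℝ e x = x (Fin.last m) := fun x => by
    simpa [e] using EuclideanSpace.inner_single_left (Fin.last m) (1 : ℝ) x
  have hu : HalfSpaceLiouville.IsHalfSpaceSolution G ((m + 1 : ℕ) + α) e (fun t => C⁻¹ * h t) u :=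
    ⟨hu_cont, hu_nonneg, fun x hx => hu_ext x (not_lt.2 (he x ▸ hx)), hu_lim,
      fun x hx => (hu_eq x (he x ▸ hx : 0 < x (Fin.last m))).hasPV hα0 hα2⟩
  have hlip : LipschitzOnWith (‖C⁻¹‖₊ * K) (fun t => C⁻¹ * h t) (Set.range u) :=
    (lipschitzWith_smul C⁻¹).comp_lipschitzOnWith hK
  exact hu.eq_zero_everywhere (by simp [e]) (by simpa using hα0) (by simpa using hα2) hc₀ hGm hG
    hG0 hlip (by simp [hh0])

theorem theorem3p3 (m : ℕ) (α : ℝ) (hα0 : 0 < α) (hα2 : α < 2)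
    (G : ℝ → ℝ) (hG : ContDiff ℝ 1 G) (hG0 : G 0 = 0)
    (c₀ : ℝ) (hc₀ : 0 < c₀) (hG' : ∀ t : ℝ, c₀ ≤ deriv G t)
    (h : ℝ → ℝ) (u : EuclideanSpace ℝ (Fin (m + 1)) → ℝ)
    (hu_L : HalfSpaceLiouville.MemLAlpha α u)
    (hu_reg : HalfSpaceLiouville.IsC11LocOn u (HalfSpaceLiouville.upperHalfSpace m))
    (hu_cont : Continuous u)
    (hu_nonneg : ∀ x, 0 ≤ u x)
    (hu_eq : ∀ x ∈ HalfSpaceLiouville.upperHalfSpace m,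
      HalfSpaceLiouville.HasFAlpha G α u x (h (u x)))
    (hu_ext : ∀ x ∉ HalfSpaceLiouville.upperHalfSpace m, u x = 0)
    (hu_lim : Tendsto u (cocompact (EuclideanSpace ℝ (Fin (m + 1)))) (𝓝 0))
    (hh_lip : ∃ K : NNReal, LipschitzOnWith K h (Set.range u))
    (hh0 : h 0 = 0) :
    ∀ x, u x = 0 :=
  theorem3p3_general m α hα0 hα2 G hG.locallyLipschitz hG0 c₀ hc₀
    (HalfSpaceLiouville.monotone_sub_mul_of_le_deriv (hG.differentiable one_ne_zero) hG')
    h u hu_cont hu_nonneg hu_eq hu_ext hu_lim hh_lip hh0
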